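/- Theorem 5.6 (maximal planar graphs). Let $G$ be a maximal planar graph on $n\ge 7$ vertices, that is, a finite simple planar graph such that no planar graph on the same vertex set properly contains it. Let $f:E(G)\to\{-1,1\}$, and write $e(c)$ for the number of edges $x$ of $G$ with $f(x)=c$. If $$\min\{e(-1),e(1)\}\ \ge\ 3\left\lfloor \tfrac{n-1}{2}\right\rfloor-5,$$ then $G$ contains a spanning tree $T$ which is zero-sum or almost zero-sum, i.e. $\sum_{x\in E(T)}f(x)\in\{-1,0,1\}$. The bound is sharp: for every $n\ge 7$ there are a maximal planar graph $G$ on $n$ vertices and a colouring $f:E(G)\to\{-1,1\}$ with $$\min\{e(-1),e(1)\}=3\left\lfloor \tfrac{n-1}{2}\right\rfloor-6$$ such that $G$ contains no zero-sum and no almost zero-sum spanning tree. -/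

import Mathlib

/-- A polygonal arc in the plane `ℝ²`: a chain of `length ≥ 1` nondegenerate straight line segments
`[pt i, pt (i + 1)]`, `i < length`, such that consecutive segments meet only in their common
endpoint and all other pairs of segments are disjoint. In other words, a union of finitely many
line segments that is homeomorphic to `[0, 1]`. (The values `pt i` with `i > length` play
no role.) -/
structure PolygonalArc where
  length : ℕ
  pt : ℕ → ℝ × ℝ
  length_pos : 0 < length
  pt_ne : ∀ i, i < length → pt i ≠ pt (i + 1)
  simple : ∀ i j, i < j → j < length → ∀ x, x ∈ segment ℝ (pt i) (pt (i + 1)) →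
    x ∈ segment ℝ (pt j) (pt (j + 1)) → j = i + 1 ∧ x = pt j

namespace PolygonalArc

/-- The set of points of the arc. -/
def carrier (A : PolygonalArc) : Set (ℝ × ℝ) :=
  {x | ∃ i < A.length, x ∈ segment ℝ (A.pt i) (A.pt (i + 1))}

/-- The unordered pair of endpoints of the arc. -/
def ends (A : PolygonalArc) : Sym2 (ℝ × ℝ) := s(A.pt 0, A.pt A.length)

end PolygonalArc

namespace SimpleGraph

variable {V : Type*}

/-- A drawing of `G` in the plane without crossings: the vertices are distinct points, every edge
is a polygonal arc that joins the points of its two endvertices, an arc contains no vertex other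
than its two ends, and two different arcs have no point in common except a common endvertex. -/
structure PlaneDrawing (G : SimpleGraph V) where
  pos : V → ℝ × ℝ
  pos_injective : Function.Injective pos
  arc : G.edgeSet → PolygonalArc
  arc_ends : ∀ e : G.edgeSet, (arc e).ends = Sym2.map pos (e : Sym2 V)
  vertex_mem_arc : ∀ (e : G.edgeSet) (v : V), pos v ∈ (arc e).carrier → v ∈ (e : Sym2 V)
  arc_inter_arc : ∀ e e' : G.edgeSet, e ≠ e' → ∀ x, x ∈ (arc e).carrier → x ∈ (arc e').carrier →
    ∃ v : V, v ∈ (e : Sym2 V) ∧ v ∈ (e' : Sym2 V) ∧ x = pos v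

/-- A graph is planar if it has a drawing in the plane without crossings. -/
def IsPlanar (G : SimpleGraph V) : Prop := Nonempty (PlaneDrawing G)

/-- A graph is maximal planar if it is planar, and no planar graph on the same
vertex set properly contains it. -/
def IsMaximalPlanar (G : SimpleGraph V) : Prop :=
  Maximal (fun H : SimpleGraph V => H.IsPlanar) G

/-- `f` colours every edge of `G` with `-1` or `1`. (Values of `f` off the edges of `G` play
no role.) -/
def IsSignColouring (G : SimpleGraph V) (f : Sym2 V → ℤ) : Prop :=
  ∀ e ∈ G.edgeSet, f e = -1 ∨ f e = 1

open Classical in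
/-- The number `e(c)` of edges of `G` with colour `c`. -/
noncomputable def colourCount [Fintype V] (G : SimpleGraph V) (f : Sym2 V → ℤ) (c : ℤ) : ℕ :=
  (G.edgeFinset.filter (fun e => f e = c)).card

open Classical in
/-- The weight `f(H)`, the sum of the colours of the edges of `H`. -/
noncomputable def weight [Fintype V] (H : SimpleGraph V) (f : Sym2 V → ℤ) : ℤ :=
  ∑ e ∈ H.edgeFinset, f e

/-- `G` has a spanning tree that is zero-sum (weight `0`) or almost zero-sum (weight `1` or `-1`)
under `f`. -/
def HasBalancedSpanningTree [Fintype V] (G : SimpleGraph V) (f : Sym2 V → ℤ) : Prop :=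
  ∃ T : SimpleGraph V, T ≤ G ∧ T.IsTree ∧ (T.weight f = 0 ∨ |T.weight f| = 1)

end SimpleGraph

-- Put `k = ⌊(n-1)/2⌋`, so that `n - 1` is `2k` or `2k + 1`. A spanning tree with at least `k` edges
-- of each colour has weight `0` or `±1`, so such a tree is what has to be found. By an exchange
-- argument (`Connected.exists_isTree_le_ncard_inter`) it exists if `G` is connected and every
-- spanning forest of each colour class has at least `k` edges. The latter follows from Euler's
-- inequality (`IsPlanar.ncard_edgeSet_le`): a planar graph whose spanning forests have at most `k -
-- 1` edges has at most `3(k-1) - 3 = 3k - 6` edges when `k ≥ 3`, one fewer than each colour class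
-- has.
--
-- Euler's inequality is proved by linear algebra over the field with two elements, in the style of
-- MacLane. The cycle space is spanned by facial walks, and every edge lies on at most two of them
-- (`PlaneDrawing.exists_faces`). Take a basis among the facial walks and add the sum of the basis
-- as one more vector. Every edge is still covered at most twice, while every nonzero cycle vector
-- has at least three edges; this bounds the dimension of the cycle space. For the spanning
-- property, an even set of edges is recovered from the parity of the number of its segments above a
-- point. This parity is constant along each facial walk and differs on the two sides of an edge
-- exactly when the edge is in the set.
--
-- Connectedness of a maximal planar graph requires drawing an edge between two unions of components
-- (`IsPlanar.exists_isPlanar_sup_edge`). The midpoint of a shortest segment between the two parts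
-- sees both of them. The component of the complement containing this midpoint is adherent to a
-- vertex of each part, and a polygonal chain through it contains a simple arc.
--
-- For sharpness, colour with `-1` the `3k - 6` edges among the first `k` vertices of a double fan.
-- A tree uses at most `k - 1` of them, so its weight is at least `2`. The same Euler inequality
-- shows that the double fan, having `3n - 6` edges, is maximal planar.

universe u

/-! ### Cyclic successors and partial sums mod 2 -/

/-- On a finite linear order there is a cyclic successor permutation. -/
theorem exists_cyclicSucc_linearOrder (α : Type*) [Fintype α] [LinearOrder α] :
    ∃ σ : Equiv.Perm α, ∀ (a : α) (g : α → ZMod 2), ∑ x, g x = 0 →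
      ∑ x with x ≤ a, g x = ∑ x with x < σ a, g x := by
  obtain ⟨n, hn⟩ : ∃ n, Fintype.card α = n := ⟨_, rfl⟩
  let e : Fin n ≃o α := Fintype.orderIsoFinOfCardEq α hn
  cases n with
  | zero => exact ⟨1, fun a => (e.symm a).elim0⟩
  | succ n =>
    refine ⟨(e.symm.toEquiv.trans (finRotate (n + 1))).trans e.toEquiv, fun a g hg => ?_⟩
    obtain ⟨i, rfl⟩ := e.surjective a
    have key : ∀ p : α → Prop, ∀ [DecidablePred p],
        ∑ x with p x, g x = ∑ j with p (e j), g (e j) := by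
      intro p _
      rw [Finset.sum_filter, Finset.sum_filter]
      exact (Equiv.sum_comp e.toEquiv (fun x => if p x then g x else 0)).symm
    rw [key, key]
    simp only [Equiv.trans_apply, RelIso.coe_fn_toEquiv, OrderIso.symm_apply_apply,
      OrderIso.le_iff_le, OrderIso.lt_iff_lt]
    -- At the last element the successor wraps around: the left side is the total sum, which is
    -- zero, and the right side is empty.
    rcases eq_or_ne i (Fin.last n) with rfl | hi
    · rw [finRotate_last]
      simp only [Fin.le_last, Finset.filter_true, Fin.not_lt_zero, Finset.filter_false,
        Finset.sum_empty]
      rw [← hg]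
      exact Equiv.sum_comp e.toEquiv g
    · refine Finset.sum_congr ?_ fun _ _ => rfl
      ext j
      simp only [Finset.mem_filter, Finset.mem_univ, true_and]
      have h : ((finRotate (n + 1)) i : ℕ) = i + 1 := coe_finRotate_of_ne_last hi
      rw [Fin.le_def, Fin.lt_def, h]
      omega

/-- The cyclic successor in each fibre of `pt`, where the fibres are ordered by `key`. -/
theorem exists_cyclicSucc {D P K : Type*} [Fintype D] [DecidableEq P] [LinearOrder K]
    (pt : D → P) (key : D → K) (inj : ∀ d d', pt d = pt d' → key d = key d' → d = d') :
    ∃ σ : Equiv.Perm D, (∀ d, pt (σ d) = pt d) ∧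
      ∀ (d : D) (g : D → ZMod 2), ∑ x with pt x = pt d, g x = 0 →
        ∑ x with pt x = pt d ∧ key x ≤ key d, g x =
          ∑ x with pt x = pt d ∧ key x < key (σ d), g x := by
  classical
  have H : ∀ p : P, ∃ σ : Equiv.Perm {d // pt d = p}, ∀ (a : {d // pt d = p}) (g : D → ZMod 2),
      ∑ x : {d // pt d = p}, g x.1 = 0 →
      ∑ x : {d // pt d = p} with key x.1 ≤ key a.1, g x.1 =
        ∑ x : {d // pt d = p} with key x.1 < key (σ a).1, g x.1 := by
    intro p
    have hi : Function.Injective fun x : {d // pt d = p} => key x.1 := fun x y h =>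
      Subtype.ext (inj _ _ (x.2.trans y.2.symm) h)
    let : LinearOrder {d // pt d = p} := LinearOrder.lift' _ hi
    obtain ⟨σ, hσ⟩ := exists_cyclicSucc_linearOrder {d // pt d = p}
    refine ⟨σ, fun a g hg => ?_⟩
    convert hσ a (fun x => g x.1) hg using 2
    all_goals ext; simp only [Finset.mem_filter]; rfl
  choose τ hτ using H
  let e := Equiv.sigmaFiberEquiv pt
  refine ⟨(e.symm.trans (Equiv.sigmaCongrRight τ)).trans e, fun d => ?_, fun d g hg => ?_⟩
  · exact (τ (pt d) ⟨d, rfl⟩).2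
  · have conv₀ : ∀ h : D → ZMod 2, ∑ x with pt x = pt d, h x =
        ∑ x : {x // pt x = pt d}, h x.1 := fun h =>
      Finset.sum_subtype (Finset.univ.filter fun x => pt x = pt d)
        (fun x => by rw [Finset.mem_filter]; exact and_iff_right (Finset.mem_univ x)) h
    have conv : ∀ q : D → Prop, ∀ [DecidablePred q], ∑ x with pt x = pt d ∧ q x, g x =
        ∑ x : {x // pt x = pt d} with q x.1, g x.1 := by
      intro q _
      rw [← Finset.filter_filter, Finset.sum_filter, conv₀, ← Finset.sum_filter]
    rw [conv, conv]
    refine hτ (pt d) ⟨d, rfl⟩ g ?_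
    rw [← hg]
    exact (conv₀ g).symm

/-! ### Vertical order of noncrossing segments -/

/-- A finite family of straight line segments that meet only in common endpoints; no segment is
vertical, and different endpoints have different first coordinates. -/
structure SegmentFamily (S : Type*) where
  l : S → ℝ × ℝ
  r : S → ℝ × ℝ
  lt : ∀ s, (l s).1 < (r s).1
  generic : ∀ p q, (p ∈ Set.range l ∪ Set.range r) → (q ∈ Set.range l ∪ Set.range r) →
    p.1 = q.1 → p = q
  inter : ∀ s t, s ≠ t → ∀ x, x ∈ segment ℝ (l s) (r s) → x ∈ segment ℝ (l t) (r t) →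
    (x = l s ∨ x = r s) ∧ (x = l t ∨ x = r t)

namespace SegmentFamily

variable {S : Type*} (A : SegmentFamily S)

noncomputable def slope (s : S) : ℝ := ((A.r s).2 - (A.l s).2) / ((A.r s).1 - (A.l s).1)

noncomputable def height (s : S) (x : ℝ) : ℝ := (A.l s).2 + A.slope s * (x - (A.l s).1)

theorem height_l (s : S) : A.height s (A.l s).1 = (A.l s).2 := by simp [height]

theorem height_r (s : S) : A.height s (A.r s).1 = (A.r s).2 := by
  have := (sub_pos.2 (A.lt s)).ne'
  rw [height, slope]
  field_simp
  ring

theorem height_sub (s : S) (x y : ℝ) : A.height s x - A.height s y = A.slope s * (x - y) := by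
  simp only [height]; ring

theorem mem_segment (s : S) {x : ℝ} (h₁ : (A.l s).1 ≤ x) (h₂ : x ≤ (A.r s).1) :
    (x, A.height s x) ∈ segment ℝ (A.l s) (A.r s) := by
  have h := sub_pos.2 (A.lt s)
  rw [segment_eq_image']
  refine ⟨(x - (A.l s).1) / ((A.r s).1 - (A.l s).1),
    ⟨div_nonneg (by linarith) h.le, (div_le_one h).2 (by linarith)⟩, ?_⟩
  ext
  · simp only [Prod.fst_add, Prod.smul_fst, Prod.fst_sub, smul_eq_mul]
    field_simp
    ring
  · simp only [Prod.snd_add, Prod.smul_snd, Prod.snd_sub, smul_eq_mul, height, slope]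
    field_simp

/-- `x` lies in the horizontal range of both `s` and `t`. -/
def Over (s t : S) (x : ℝ) : Prop :=
  ((A.l s).1 ≤ x ∧ x ≤ (A.r s).1) ∧ ((A.l t).1 ≤ x ∧ x ≤ (A.r t).1)

theorem endpoint_of_height_eq {s t : S} (hst : s ≠ t) {x : ℝ} (hx : A.Over s t x)
    (h : A.height t x = A.height s x) :
    (x = (A.l s).1 ∨ x = (A.r s).1) ∧ (x = (A.l t).1 ∨ x = (A.r t).1) := by
  have h1 := A.mem_segment s hx.1.1 hx.1.2
  have h2 := A.mem_segment t hx.2.1 hx.2.2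
  rw [h] at h2
  obtain ⟨h3, h4⟩ := A.inter s t hst _ h1 h2
  exact ⟨h3.imp (congrArg Prod.fst) (congrArg Prod.fst),
    h4.imp (congrArg Prod.fst) (congrArg Prod.fst)⟩

/-- Two segments of the family do not change their vertical order. -/
theorem height_lt_of_height_lt {s t : S} (hst : s ≠ t) {x y : ℝ} (hx : A.Over s t x)
    (hy : A.Over s t y) (h : A.height s x < A.height t x) (hne : A.height t y ≠ A.height s y) :
    A.height s y < A.height t y := by
  by_contra hcon
  have hlt : A.height t y < A.height s y := lt_of_le_of_ne (not_lt.1 hcon) hne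
  have hs := A.height_sub s y x
  have ht := A.height_sub t y x
  set m := A.height t x - A.height s x with hm
  set k := A.height s y - A.height t y with hk
  have hm0 : 0 < m := sub_pos.2 h
  have hk0 : 0 < k := sub_pos.2 hlt
  have hmk : 0 < m + k := by positivity
  -- The difference of the heights is affine with values `m` at `x` and `-k` at `y`, so it vanishes
  -- at the fraction `m / (m + k)` of the way. The segments would meet there, at a point that is not
  -- an end of `s`.
  set c := m / (m + k) with hc
  have hc0 : 0 < c := by positivity
  have hc1 : c < 1 := by rw [hc, div_lt_one hmk]; linarith
  set w := x + c * (y - x) with hw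
  have e1 := A.height_sub s w x
  have e2 := A.height_sub t w x
  have hz : A.height t w = A.height s w := by
    have hcm : c * (m + k) = m := by rw [hc]; field_simp
    have e3 : w - x = c * (y - x) := by rw [hw]; ring
    rw [e3] at e1 e2
    have : A.height t w - A.height s w = m - c * (m + k) := by
      have : c * (m + k) = c * ((A.slope s - A.slope t) * (y - x)) := by
        congr 1; linarith
      linarith
    linarith
  have hxy : x ≠ y := by rintro rfl; exact absurd h hcon
  have hwx : ∀ u, u ≤ x → u ≤ y → u < w := by
    intro u h1 h2
    rcases lt_or_gt_of_ne hxy with h3 | h3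
    · have := mul_pos hc0 (sub_pos.2 h3); linarith
    · have := mul_pos (sub_pos.2 hc1) (sub_pos.2 h3); nlinarith
  have hxw : ∀ u, x ≤ u → y ≤ u → w < u := by
    intro u h1 h2
    rcases lt_or_gt_of_ne hxy with h3 | h3
    · have := mul_pos (sub_pos.2 hc1) (sub_pos.2 h3); nlinarith
    · have := mul_pos hc0 (sub_pos.2 h3); linarith
  have a1 := hwx _ hx.1.1 hy.1.1
  have a2 := hwx _ hx.2.1 hy.2.1
  have a3 := hxw _ hx.1.2 hy.1.2
  have a4 := hxw _ hx.2.2 hy.2.2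
  rcases (A.endpoint_of_height_eq hst ⟨⟨a1.le, a3.le⟩, ⟨a2.le, a4.le⟩⟩ hz).1 with h5 | h5
  · exact a1.ne' h5
  · exact a3.ne h5

/-- `t` lies above `s`. -/
def Above (s t : S) : Prop := ∃ x, A.Over s t x ∧ A.height s x < A.height t x

theorem l_eq {s t : S} (h : (A.l s).1 = (A.l t).1) : A.l s = A.l t :=
  A.generic _ _ (.inl ⟨s, rfl⟩) (.inl ⟨t, rfl⟩) h

theorem r_eq {s t : S} (h : (A.r s).1 = (A.r t).1) : A.r s = A.r t :=
  A.generic _ _ (.inr ⟨s, rfl⟩) (.inr ⟨t, rfl⟩) h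

theorem l_eq_r {s t : S} (h : (A.l s).1 = (A.r t).1) : A.l s = A.r t :=
  A.generic _ _ (.inl ⟨s, rfl⟩) (.inr ⟨t, rfl⟩) h

/-- Both sides describe the segments that run above `s` just to the right of its left end. The left
side is the form in which `parityAbove` and the order of the darts at `l s` count them; the right
side is free of slopes and can be compared with the other end of `s`. -/
theorem above_left_iff {s t : S} (hst : s ≠ t) :
    ((A.l t).1 < (A.l s).1 ∧ (A.l s).1 < (A.r t).1 ∧ (A.l s).2 < A.height t (A.l s).1) ∨
      (A.l t = A.l s ∧ A.slope s < A.slope t) ↔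
    (A.l t).1 ≤ (A.l s).1 ∧ (A.l s).1 < (A.r t).1 ∧ A.Above s t := by
  have hs := A.lt s
  have ht := A.lt t
  constructor
  · rintro (⟨h1, h2, h3⟩ | ⟨h1, h2⟩)
    · exact ⟨h1.le, h2, (A.l s).1, ⟨⟨le_rfl, hs.le⟩, h1.le, h2.le⟩, by rwa [A.height_l]⟩
    · refine ⟨by rw [h1], by rw [← h1]; exact ht, min (A.r s).1 (A.r t).1, ⟨⟨?_, ?_⟩, ?_, ?_⟩, ?_⟩
      · exact le_min hs.le (by rw [← h1]; exact ht.le)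
      · exact min_le_left _ _
      · exact le_min (by rw [h1]; exact hs.le) ht.le
      · exact min_le_right _ _
      · have h3 : (A.l s).1 < min (A.r s).1 (A.r t).1 := lt_min hs (by rw [← h1]; exact ht)
        simp only [height, h1]
        have := mul_lt_mul_of_pos_right h2 (sub_pos.2 h3)
        linarith
  · rintro ⟨h1, h2, x, hx, hlt⟩
    rcases h1.lt_or_eq with h1 | h1
    · refine .inl ⟨h1, h2, ?_⟩
      have ho : A.Over s t (A.l s).1 := ⟨⟨le_rfl, hs.le⟩, h1.le, h2.le⟩
      have := A.height_lt_of_height_lt hst hx ho hlt fun h => by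
        rcases (A.endpoint_of_height_eq hst ho h).2 with h | h
        · exact h1.ne' h
        · exact h2.ne h
      rwa [A.height_l] at this
    · have h1 := A.l_eq h1
      refine .inr ⟨h1, ?_⟩
      simp only [height, h1] at hlt
      by_contra h3
      have := mul_le_mul_of_nonneg_right (not_lt.1 h3) (sub_nonneg.2 hx.1.1)
      linarith

/-- The mirror image at the right end. The slope inequality is reversed because the segments leave a
common right end towards the left. -/
theorem above_right_iff {s t : S} (hst : s ≠ t) :
    ((A.l t).1 < (A.r s).1 ∧ (A.r s).1 < (A.r t).1 ∧ (A.r s).2 < A.height t (A.r s).1) ∨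
      (A.r t = A.r s ∧ A.slope t < A.slope s) ↔
    (A.l t).1 < (A.r s).1 ∧ (A.r s).1 ≤ (A.r t).1 ∧ A.Above s t := by
  have hs := A.lt s
  have ht := A.lt t
  constructor
  · rintro (⟨h1, h2, h3⟩ | ⟨h1, h2⟩)
    · exact ⟨h1, h2.le, (A.r s).1, ⟨⟨hs.le, le_rfl⟩, h1.le, h2.le⟩, by rwa [A.height_r]⟩
    · refine ⟨by rw [← h1]; exact ht, by rw [h1], max (A.l s).1 (A.l t).1, ⟨⟨?_, ?_⟩, ?_, ?_⟩, ?_⟩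
      · exact le_max_left _ _
      · exact max_le hs.le (by rw [← h1]; exact ht.le)
      · exact le_max_right _ _
      · exact max_le (by rw [h1]; exact hs.le) ht.le
      · have h3 : max (A.l s).1 (A.l t).1 < (A.r s).1 := max_lt hs (by rw [← h1]; exact ht)
        have e1 := A.height_sub s (max (A.l s).1 (A.l t).1) (A.r s).1
        have e2 := A.height_sub t (max (A.l s).1 (A.l t).1) (A.r t).1
        rw [A.height_r] at e1 e2
        rw [h1] at e2
        have := mul_lt_mul_of_pos_right h2 (sub_pos.2 h3)
        linarith
  · rintro ⟨h1, h2, x, hx, hlt⟩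
    rcases h2.lt_or_eq with h2 | h2
    · refine .inl ⟨h1, h2, ?_⟩
      have ho : A.Over s t (A.r s).1 := ⟨⟨hs.le, le_rfl⟩, h1.le, h2.le⟩
      have := A.height_lt_of_height_lt hst hx ho hlt fun h => by
        rcases (A.endpoint_of_height_eq hst ho h).2 with h | h
        · exact h1.ne' h
        · exact h2.ne h
      rwa [A.height_r] at this
    · have h2 := (A.r_eq h2).symm
      refine .inr ⟨h2, ?_⟩
      have e1 := A.height_sub s x (A.r s).1
      have e2 := A.height_sub t x (A.r t).1
      rw [A.height_r] at e1 e2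
      rw [h2] at e2
      by_contra h3
      have := mul_le_mul_of_nonneg_right (not_lt.1 h3) (sub_nonneg.2 hx.1.2)
      linarith

theorem endpoint_above_iff {s t : S} (hst : s ≠ t) {x : ℝ} (hx : (A.l s).1 < x ∧ x < (A.r s).1)
    (ht : (A.l t).1 ≤ x ∧ x ≤ (A.r t).1) : A.height s x < A.height t x ↔ A.Above s t := by
  have ho : A.Over s t x := ⟨⟨hx.1.le, hx.2.le⟩, ht⟩
  refine ⟨fun h => ⟨x, ho, h⟩, fun ⟨y, hy, hlt⟩ => ?_⟩
  refine A.height_lt_of_height_lt hst hy ho hlt fun h => ?_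
  rcases (A.endpoint_of_height_eq hst ho h).1 with h | h
  · exact hx.1.ne' h
  · exact hx.2.ne h

/-- The horizontal ranges share at most one abscissa, and by genericity the two ends over it are the
same point, so neither segment is higher. -/
theorem not_above_of_le {s t : S} (h : (A.r s).1 ≤ (A.l t).1) : ¬ A.Above s t := by
  rintro ⟨x, hx, hlt⟩
  have h1 : x = (A.l t).1 := le_antisymm (hx.1.2.trans h) hx.2.1
  have h2 : x = (A.r s).1 := le_antisymm hx.1.2 (h.trans hx.2.1)
  have h3 := A.l_eq_r (h1.symm.trans h2)
  have h4 := A.height_l t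
  have h5 := A.height_r s
  rw [← h2] at h5
  rw [← h1] at h4
  rw [h4, h5, h3] at hlt
  exact lt_irrefl _ hlt

theorem not_above_of_ge {s t : S} (h : (A.r t).1 ≤ (A.l s).1) : ¬ A.Above s t := by
  rintro ⟨x, hx, hlt⟩
  have h1 : x = (A.r t).1 := le_antisymm hx.2.2 (h.trans hx.1.1)
  have h2 : x = (A.l s).1 := le_antisymm (hx.2.2.trans h) hx.1.1
  have h3 := A.l_eq_r (h2.symm.trans h1)
  have h4 := A.height_r t
  have h5 := A.height_l s
  rw [← h2] at h5
  rw [← h1] at h4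
  rw [h4, h5, h3] at hlt
  exact lt_irrefl _ hlt

end SegmentFamily

/-! ### Darts, facial walks and the parity function -/

namespace SegmentFamily

variable {S : Type*} (A : SegmentFamily S)

/-- The base point of a dart: `(s, false)` is `s` seen from its left end, `(s, true)` is `s` seen
from its right end. -/
def pt (d : S × Bool) : ℝ × ℝ := if d.2 then A.r d.1 else A.l d.1

/-- Increasing `key` orders the darts at a point clockwise, starting from the upward direction. -/
noncomputable def key (d : S × Bool) : Bool ×ₗ ℝ := toLex (d.2, -A.slope d.1)

/-- Two segments leaving a point on the same side with equal slope would overlap, so they would meet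
over an interior abscissa of both. -/
theorem key_injective (d d' : S × Bool) (h : A.pt d = A.pt d') (hk : A.key d = A.key d') :
    d = d' := by
  obtain ⟨s, b⟩ := d
  obtain ⟨t, b'⟩ := d'
  simp only [key, EmbeddingLike.apply_eq_iff_eq, Prod.mk.injEq, neg_inj] at hk
  obtain ⟨rfl, hk⟩ := hk
  congr 1
  by_contra hst
  have hs := A.lt s
  have ht := A.lt t
  cases b
  · simp only [pt, Bool.false_eq_true, if_false] at h
    have hm : (A.l s).1 < min (A.r s).1 (A.r t).1 := lt_min hs (by rw [h]; exact ht)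
    obtain ⟨x, h1, h2⟩ := exists_between hm
    have h3 := h2.trans_le (min_le_left _ _)
    have h4 := h2.trans_le (min_le_right _ _)
    rcases (A.endpoint_of_height_eq hst (x := x) ⟨⟨h1.le, h3.le⟩, by rw [← h]; exact h1.le, h4.le⟩
      (by simp only [height, h, hk])).1 with h5 | h5
    · exact h1.ne' h5
    · exact h3.ne h5
  · simp only [pt, if_true] at h
    have hm : max (A.l s).1 (A.l t).1 < (A.r s).1 := max_lt hs (by rw [h]; exact ht)
    obtain ⟨x, h1, h2⟩ := exists_between hm
    have h3 := (le_max_left _ _).trans_lt h1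
    have h4 := (le_max_right _ _).trans_lt h1
    have e1 := A.height_sub s x (A.r s).1
    have e2 := A.height_sub t x (A.r t).1
    rw [A.height_r] at e1 e2
    rw [← h, ← hk] at e2
    rcases (A.endpoint_of_height_eq hst (x := x) ⟨⟨h3.le, h2.le⟩, h4.le, by rw [← h]; exact h2.le⟩
      (by linarith)).1 with h5 | h5
    · exact h3.ne' h5
    · exact h2.ne h5

open Classical in
/-- An even set of segments, given by its indicator function: every point is the end of an even
number of segments. -/
def IsEven [Fintype S] (z : S → ZMod 2) : Prop :=
  ∀ p, ∑ d with A.pt d = p, z d.1 = 0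

open Classical in
/-- The parity of the number of segments of `z` that pass strictly above `p`. -/
noncomputable def parityAbove [Fintype S] (z : S → ZMod 2) (p : ℝ × ℝ) : ZMod 2 :=
  ∑ t with (A.l t).1 < p.1 ∧ p.1 < (A.r t).1 ∧ p.2 < A.height t p.1, z t

open Classical in
theorem IsEven.sum_mul_eq_zero [Fintype S] {A : SegmentFamily S} {z : S → ZMod 2}
    (hz : A.IsEven z) (g : ℝ × ℝ → ZMod 2) : ∑ d, g (A.pt d) * z d.1 = 0 := by
  rw [← Finset.sum_fiberwise_of_maps_to (t := Finset.univ.image A.pt) (g := A.pt) (by simp)]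
  refine Finset.sum_eq_zero fun p _ => ?_
  rw [Finset.sum_congr rfl (g := fun d => g p * z d.1)
    (fun d hd => by rw [(Finset.mem_filter.1 hd).2]), ← Finset.mul_sum, hz, mul_zero]

-- Walking along the upper side of `s`, the set of segments overhead changes only where a segment
-- above `s` begins or ends. By evenness, the ends of segments of `z` in the region above `s` are
-- even in number, so the parity overhead is the same at both ends of `s`.
open Classical in
theorem parityAbove_along [Fintype S] {z : S → ZMod 2} (hz : A.IsEven z) (s : S) :
    A.parityAbove z (A.l s) + ∑ t with A.l t = A.l s ∧ A.slope s < A.slope t, z t =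
      A.parityAbove z (A.r s) + ∑ t with A.r t = A.r s ∧ A.slope t < A.slope s, z t := by
  have hs := A.lt s
  have hA : A.parityAbove z (A.l s) + ∑ t with A.l t = A.l s ∧ A.slope s < A.slope t, z t =
      ∑ t, if t ≠ s ∧ (A.l t).1 ≤ (A.l s).1 ∧ (A.l s).1 < (A.r t).1 ∧ A.Above s t
        then z t else 0 := by
    rw [parityAbove, Finset.sum_filter, Finset.sum_filter, ← Finset.sum_add_distrib]
    refine Finset.sum_congr rfl fun t _ => ?_
    rcases eq_or_ne t s with rfl | hts
    · simp
    · have := A.above_left_iff hts.symm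
      by_cases h : A.l t = A.l s
      · simp only [h, lt_irrefl, false_and, if_false, true_and, zero_add, false_or] at this ⊢
        simp only [this, hts, ne_eq, not_false_eq_true, true_and]
      · simp only [h, false_and, or_false, if_false, add_zero] at this ⊢
        simp only [this, hts, ne_eq, not_false_eq_true, true_and]
  have hB : A.parityAbove z (A.r s) + ∑ t with A.r t = A.r s ∧ A.slope t < A.slope s, z t =
      ∑ t, if t ≠ s ∧ (A.l t).1 < (A.r s).1 ∧ (A.r s).1 ≤ (A.r t).1 ∧ A.Above s t
        then z t else 0 := by
    rw [parityAbove, Finset.sum_filter, Finset.sum_filter, ← Finset.sum_add_distrib]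
    refine Finset.sum_congr rfl fun t _ => ?_
    rcases eq_or_ne t s with rfl | hts
    · simp
    · have := A.above_right_iff hts.symm
      by_cases h : A.r t = A.r s
      · simp only [h, lt_irrefl, false_and, and_false, if_false, true_and, zero_add,
          false_or] at this ⊢
        simp only [this, hts, ne_eq, not_false_eq_true, true_and]
      · simp only [h, false_and, or_false, if_false, add_zero] at this ⊢
        simp only [this, hts, ne_eq, not_false_eq_true, true_and]
  -- The weight is the indicator of the open vertical strip over `s`, restricted to the points above
  -- `s`.
  have h0 := hz.sum_mul_eq_zero fun p =>
    if (A.l s).1 < p.1 ∧ p.1 < (A.r s).1 ∧ A.height s p.1 < p.2 then 1 else 0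
  rw [Fintype.sum_prod_type] at h0
  simp only [Fintype.sum_bool, pt, if_true, Bool.false_eq_true, if_false] at h0
  rw [hA, hB, ← sub_eq_zero, CharTwo.sub_eq_add, ← Finset.sum_add_distrib]
  refine Eq.trans ?_ h0
  refine Finset.sum_congr rfl fun t _ => ?_
  rcases eq_or_ne t s with rfl | hts
  · simp
  have ht := A.lt t
  have hl : ((A.l s).1 < (A.l t).1 ∧ (A.l t).1 < (A.r s).1 ∧ A.height s (A.l t).1 < (A.l t).2) ↔
      (A.l s).1 < (A.l t).1 ∧ (A.l t).1 < (A.r s).1 ∧ A.Above s t := by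
    rw [← and_assoc, ← and_assoc]
    refine and_congr_right fun h => ?_
    rw [← A.endpoint_above_iff hts.symm h ⟨le_rfl, ht.le⟩, A.height_l]
  have hr : ((A.l s).1 < (A.r t).1 ∧ (A.r t).1 < (A.r s).1 ∧ A.height s (A.r t).1 < (A.r t).2) ↔
      (A.l s).1 < (A.r t).1 ∧ (A.r t).1 < (A.r s).1 ∧ A.Above s t := by
    rw [← and_assoc, ← and_assoc]
    refine and_congr_right fun h => ?_
    rw [← A.endpoint_above_iff hts.symm h ⟨ht.le, le_rfl⟩, A.height_r]
  simp only [hl, hr]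
  by_cases hab : A.Above s t
  -- For `t` above `s`, either `t` already runs overhead at the left end of `s` or its own left end
  -- lies in the strip, and never both; the same holds on the right. The four indicators therefore
  -- sum to `2`.
  · have h1 : (A.l t).1 < (A.r s).1 := not_le.1 fun h => A.not_above_of_le h hab
    have h2 : (A.l s).1 < (A.r t).1 := not_le.1 fun h => A.not_above_of_ge h hab
    have hzz := CharTwo.add_self_eq_zero (z t)
    rcases le_or_gt (A.l t).1 (A.l s).1 with h3 | h3 <;>
      rcases le_or_gt (A.r s).1 (A.r t).1 with h4 | h4 <;>
      simp [hab, h1, h2, h3, h4, hts, not_le_of_gt, not_lt_of_ge, hzz]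
  · simp [hab]

/-- The even sets of segments are generated by a family (the boundaries of the faces) in which
every segment occurs at most twice. -/
theorem exists_faces {S : Type u} [Fintype S] (A : SegmentFamily S) :
    ∃ (F : Type u) (_ : Fintype F) (b : F → S → ZMod 2), (∀ f, A.IsEven (b f)) ∧
      (∀ s, Set.ncard {f | b f s ≠ 0} ≤ 2) ∧
      ∀ z, A.IsEven z → ∃ c : F → ZMod 2, z = ∑ f, c f • b f := by
  classical
  obtain ⟨σ, hσ, hσs⟩ := exists_cyclicSucc A.pt A.key A.key_injective
  let rev : S × Bool → S × Bool := fun d => (d.1, !d.2)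
  -- A pair `(d, b)` is a side of the dart `d`: `true` is the clockwise side and `false` the
  -- counterclockwise one. The clockwise side of `d` is glued to the counterclockwise side of the
  -- next dart at the same point, and to the same side of the segment seen from its other end. The
  -- classes are the facial walks.
  let rel : (S × Bool) × Bool → (S × Bool) × Bool → Prop := fun x y =>
    x.2 = true ∧ (y = (σ x.1, false) ∨ y = (rev x.1, false))
  let F := Quot rel
  let mk : (S × Bool) → Bool → F := fun d b => Quot.mk rel (d, b)
  have mkσ : ∀ d, mk (σ d) false = mk d true := fun d => (Quot.sound ⟨rfl, .inl rfl⟩).symm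
  have mkr : ∀ d, mk (rev d) false = mk d true := fun d => (Quot.sound ⟨rfl, .inr rfl⟩).symm
  have revrev : ∀ d, rev (rev d) = d := fun d => by simp [rev]
  have mkr' : ∀ d, mk (rev d) true = mk d false := fun d => by rw [← mkr, revrev]
  let β : F → S × Bool → ZMod 2 := fun f d =>
    (if mk d true = f then 1 else 0) + (if mk d false = f then 1 else 0)
  have βrev : ∀ f d, β f (rev d) = β f d := fun f d => by
    simp only [β, mkr, mkr']; rw [add_comm]
  have hF : Finite F := Quot.finite rel
  let instF : Fintype F := Fintype.ofFinite F
  refine ⟨F, instF, fun f s => β f (s, false), ?_, ?_, ?_⟩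
  · intro f p
    have h1 : ∀ d : S × Bool, β f (d.1, false) = β f d := by
      rintro ⟨s, b⟩
      cases b
      · rfl
      · exact βrev f (s, true)
    simp only [h1, β]
    rw [Finset.sum_add_distrib]
    -- Around `p`, the rotation `σ` matches the clockwise sides with the counterclockwise sides in
    -- the same class.
    have h2 : ∑ d with A.pt d = p, (if mk d false = f then 1 else 0 : ZMod 2) =
        ∑ d with A.pt d = p, if mk d true = f then 1 else 0 := by
      rw [Finset.sum_filter, Finset.sum_filter, ← Equiv.sum_comp σ]
      simp only [hσ, mkσ]
    rw [h2, CharTwo.add_self_eq_zero]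
  · intro s
    refine (Set.ncard_le_ncard (t := {mk (s, false) true, mk (s, false) false}) ?_
      (Set.toFinite _)).trans ((Set.ncard_insert_le _ _).trans (by simp))
    intro f hf
    by_contra hcon
    simp only [Set.mem_insert_iff, Set.mem_singleton_iff, not_or] at hcon
    exact hf (by simp [β, Ne.symm hcon.1, Ne.symm hcon.2])
  · intro z hz
    -- This is the parity of `z` overhead in the sector beside the dart: the segments above the base
    -- point, plus those at the base point crossed when turning clockwise from the upward direction.
    let w : (S × Bool) × Bool → ZMod 2 := fun x => A.parityAbove z (A.pt x.1) +
      if x.2 then ∑ d with A.pt d = A.pt x.1 ∧ A.key d ≤ A.key x.1, z d.1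
      else ∑ d with A.pt d = A.pt x.1 ∧ A.key d < A.key x.1, z d.1
    have hdiff : ∀ d, ∑ d' with A.pt d' = A.pt d ∧ A.key d' ≤ A.key d, z d'.1 =
        z d.1 + ∑ d' with A.pt d' = A.pt d ∧ A.key d' < A.key d, z d'.1 := by
      intro d
      rw [← Finset.sum_insert (f := fun d' : S × Bool => z d'.1) (by simp)]
      refine Finset.sum_congr ?_ fun _ _ => rfl
      ext d'
      simp only [Finset.mem_filter, Finset.mem_univ, true_and, Finset.mem_insert]
      constructor
      · rintro ⟨h1, h2⟩
        rcases h2.lt_or_eq with h2 | h2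
        · exact .inr ⟨h1, h2⟩
        · exact .inl (A.key_injective _ _ h1 h2)
      · rintro (rfl | ⟨h1, h2⟩)
        · exact ⟨rfl, le_rfl⟩
        · exact ⟨h1, h2.le⟩
    have hwl : ∀ s : S, w ((s, false), false) = A.parityAbove z (A.l s) +
        ∑ t with A.l t = A.l s ∧ A.slope s < A.slope t, z t := by
      intro s
      simp only [w, Bool.false_eq_true, if_false]
      congr 1
      rw [Finset.sum_filter, Finset.sum_filter, Fintype.sum_prod_type]
      refine Finset.sum_congr rfl fun t _ => ?_
      simp [pt, key, Prod.Lex.toLex_lt_toLex]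
    have hwr : ∀ s : S, w ((s, true), true) = A.parityAbove z (A.r s) +
        ∑ t with A.r t = A.r s ∧ A.slope t < A.slope s, z t := by
      intro s
      simp only [w, if_true]
      congr 1
      have h1 : ∑ d with A.pt d = A.pt (s, true) ∧ A.key (s, true) < A.key d, z d.1 =
          ∑ t with A.r t = A.r s ∧ A.slope t < A.slope s, z t := by
        rw [Finset.sum_filter, Finset.sum_filter, Fintype.sum_prod_type]
        refine Finset.sum_congr rfl fun t _ => ?_
        simp [pt, key, Prod.Lex.toLex_lt_toLex]
      -- All darts at the point sum to zero, so the darts up to `(s, true)` can be exchanged for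
      -- those after it, which are the left-going ones above `s`.
      rw [← h1, ← sub_eq_zero, CharTwo.sub_eq_add, ← hz (A.pt (s, true))]
      simp only [← not_le (a := A.key _) (b := A.key (s, true))]
      rw [← Finset.filter_filter, ← Finset.filter_filter, Finset.sum_filter_add_sum_filter_not]
    have hw : ∀ x y, rel x y → w x = w y := by
      rintro ⟨d, b⟩ y ⟨hb, hy⟩
      obtain rfl : b = true := hb
      rcases hy with rfl | rfl
      · simp only [w, hσ, if_true, Bool.false_eq_true, if_false]
        rw [hσs d (fun d => z d.1) (hz _)]
      · obtain ⟨s, b⟩ := d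
        cases b
        · have h1 := hwl s
          have h2 := hwr s
          have h3 := A.parityAbove_along hz s
          rw [← h1, ← h2] at h3
          have h4 := hdiff (s, false)
          have h5 := hdiff (s, true)
          simp only [w, rev, if_true, Bool.false_eq_true, if_false, Bool.not_false] at h3 ⊢
          rw [h4, add_left_comm, h3, h5]
          rw [← add_assoc, ← add_assoc, add_comm (z s) _, add_assoc _ (z s) (z s),
            CharTwo.add_self_eq_zero, add_zero]
        · have h1 := hwl s
          have h2 := hwr s
          have h3 := A.parityAbove_along hz s
          rw [← h1, ← h2] at h3
          exact h3.symm
    let W : F → ZMod 2 := Quot.lift w hw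
    refine ⟨W, ?_⟩
    ext s
    have h0 : (∑ f, W f • fun s => β f (s, false)) s =
        W (mk (s, false) true) + W (mk (s, false) false) := by
      simp [β, Finset.sum_apply, mul_add, Finset.sum_add_distrib]
    rw [h0]
    change z s = w ((s, false), true) + w ((s, false), false)
    have h4 := hdiff (s, false)
    simp only [w, if_true, Bool.false_eq_true, if_false]
    rw [h4, add_add_add_comm, CharTwo.add_self_eq_zero, zero_add, add_assoc,
      CharTwo.add_self_eq_zero, add_zero]

end SegmentFamily

/-! ### From generic segments to plane drawings -/

open Classical in
/-- The even sets of a finite family of noncrossing segments `[a s, b s]` are generated by a family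
in which every segment occurs at most twice. -/
theorem exists_faces_of_segments {S : Type u} [Fintype S] (a b : S → ℝ × ℝ) (hab : ∀ s, a s ≠ b s)
    (inter : ∀ s t, s ≠ t → ∀ x, x ∈ segment ℝ (a s) (b s) → x ∈ segment ℝ (a t) (b t) →
      (x = a s ∨ x = b s) ∧ (x = a t ∨ x = b t)) :
    ∃ (F : Type u) (_ : Fintype F) (y : F → S → ZMod 2),
      (∀ f p, ∑ s, ((if a s = p then 1 else 0) + (if b s = p then 1 else 0)) * y f s = 0) ∧
      (∀ s, Set.ncard {f | y f s ≠ 0} ≤ 2) ∧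
      ∀ z : S → ZMod 2,
        (∀ p, ∑ s, ((if a s = p then 1 else 0) + (if b s = p then 1 else 0)) * z s = 0) →
        ∃ c : F → ZMod 2, z = ∑ f, c f • y f := by
  let P : Set (ℝ × ℝ) := Set.range a ∪ Set.range b
  have hP : P.Finite := (Set.finite_range a).union (Set.finite_range b)
  -- The shear `(x, y) ↦ (x + c * y, y)` makes the first coordinates of all endpoints distinct
  -- unless `c` is one of finitely many quotients.
  obtain ⟨c, hc⟩ := ((hP.prod hP).image
    fun x : (ℝ × ℝ) × (ℝ × ℝ) => (x.2.1 - x.1.1) / (x.1.2 - x.2.2)).exists_notMem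
  have hgen : ∀ p ∈ P, ∀ q ∈ P, p.1 + c * p.2 = q.1 + c * q.2 → p = q := by
    intro p hp q hq h
    by_cases h2 : p.2 = q.2
    · rw [h2] at h
      exact Prod.ext (by linarith) h2
    · refine absurd ⟨(p, q), ⟨hp, hq⟩, ?_⟩ hc
      have := sub_ne_zero.2 h2
      simp only
      rw [div_eq_iff this]
      linarith
  let φ : (ℝ × ℝ) →ₗ[ℝ] (ℝ × ℝ) :=
    (LinearMap.fst ℝ ℝ ℝ + c • LinearMap.snd ℝ ℝ ℝ).prod (LinearMap.snd ℝ ℝ ℝ)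
  have hφ1 : ∀ p, (φ p).1 = p.1 + c * p.2 := fun p => rfl
  have hφ2 : ∀ p, (φ p).2 = p.2 := fun p => rfl
  have hφ : Function.Injective φ := by
    intro p q h
    have h2 := congrArg Prod.snd h
    have h1 := congrArg Prod.fst h
    rw [hφ2, hφ2] at h2
    rw [hφ1, hφ1] at h1
    rw [h2] at h1
    exact Prod.ext (by linarith) h2
  have haP : ∀ s, a s ∈ P := fun s => .inl ⟨s, rfl⟩
  have hbP : ∀ s, b s ∈ P := fun s => .inr ⟨s, rfl⟩
  let l : S → ℝ × ℝ := fun s => if (φ (a s)).1 < (φ (b s)).1 then φ (a s) else φ (b s)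
  let r : S → ℝ × ℝ := fun s => if (φ (a s)).1 < (φ (b s)).1 then φ (b s) else φ (a s)
  have hlr : ∀ s, (l s = φ (a s) ∧ r s = φ (b s) ∧ (φ (a s)).1 < (φ (b s)).1) ∨
      (l s = φ (b s) ∧ r s = φ (a s) ∧ (φ (b s)).1 < (φ (a s)).1) := by
    intro s
    by_cases h : (φ (a s)).1 < (φ (b s)).1
    · exact .inl ⟨if_pos h, if_pos h, h⟩
    · exact .inr ⟨if_neg h, if_neg h, lt_of_le_of_ne (not_lt.1 h) fun h =>
        hab s (hgen _ (haP s) _ (hbP s) h.symm)⟩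
  have hseg : ∀ s, segment ℝ (l s) (r s) = φ '' segment ℝ (a s) (b s) := by
    intro s
    have h := image_segment ℝ φ.toAffineMap (a s) (b s)
    rcases hlr s with ⟨h1, h2, -⟩ | ⟨h1, h2, -⟩
    · rw [h1, h2]; exact h.symm
    · rw [h1, h2, segment_symm]; exact h.symm
  have hends : ∀ s x, (x = a s ∨ x = b s) → (φ x = l s ∨ φ x = r s) := by
    rintro s x (rfl | rfl) <;> rcases hlr s with ⟨h1, h2, -⟩ | ⟨h1, h2, -⟩ <;> simp [h1, h2]
  have hP' : ∀ p, p ∈ Set.range l ∪ Set.range r → ∃ q ∈ P, p = φ q := by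
    rintro p (⟨s, rfl⟩ | ⟨s, rfl⟩) <;> rcases hlr s with ⟨h1, h2, -⟩ | ⟨h1, h2, -⟩
    · exact ⟨_, haP s, h1⟩
    · exact ⟨_, hbP s, h1⟩
    · exact ⟨_, hbP s, h2⟩
    · exact ⟨_, haP s, h2⟩
  let A : SegmentFamily S :=
    { l := l
      r := r
      lt := fun s => by rcases hlr s with ⟨h1, h2, h3⟩ | ⟨h1, h2, h3⟩ <;> rwa [h1, h2]
      generic := fun p q hp hq h => by
        obtain ⟨p', hp', rfl⟩ := hP' p hp
        obtain ⟨q', hq', rfl⟩ := hP' q hq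
        rw [hgen p' hp' q' hq' h]
      inter := fun s t hst x hx hx' => by
        rw [hseg] at hx hx'
        obtain ⟨y, hy, rfl⟩ := hx
        obtain ⟨y', hy', h⟩ := hx'
        obtain rfl := hφ h
        obtain ⟨h1, h2⟩ := inter s t hst y' hy hy'
        exact ⟨hends _ _ h1, hends _ _ h2⟩ }
  have hsum : ∀ (z : S → ZMod 2) p, ∑ d with A.pt d = p, z d.1 =
      ∑ s, ((if φ (a s) = p then 1 else 0) + (if φ (b s) = p then 1 else 0)) * z s := by
    intro z p
    rw [Finset.sum_filter, Fintype.sum_prod_type]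
    refine Finset.sum_congr rfl fun s _ => ?_
    simp only [Fintype.sum_bool, SegmentFamily.pt, if_true, Bool.false_eq_true, if_false, add_mul,
      ite_mul, one_mul, zero_mul]
    rcases hlr s with ⟨h1, h2, -⟩ | ⟨h1, h2, -⟩
    · simp only [A, h1, h2]; rw [add_comm]
    · simp only [A, h1, h2]
  have heven : ∀ z : S → ZMod 2, A.IsEven z ↔
      ∀ p, ∑ s, ((if a s = p then 1 else 0) + (if b s = p then 1 else 0)) * z s = 0 := by
    intro z
    constructor
    · intro h p
      have := h (φ p)
      rw [hsum] at this
      simpa only [hφ.eq_iff] using this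
    · intro h p
      rw [hsum]
      by_cases hp : ∃ q, φ q = p
      · obtain ⟨q, rfl⟩ := hp
        simpa only [hφ.eq_iff] using h q
      · refine Finset.sum_eq_zero fun s _ => ?_
        rw [if_neg fun h => hp ⟨_, h⟩, if_neg fun h => hp ⟨_, h⟩, add_zero, zero_mul]
  obtain ⟨F, hF, y, h1, h2, h3⟩ := A.exists_faces
  exact ⟨F, hF, y, fun f => (heven _).1 (h1 f), h2, fun z hz => h3 z ((heven z).2 hz)⟩

namespace PolygonalArc

theorem eq_zero_of_pt_zero_mem (A : PolygonalArc) {i : ℕ} (hi : i < A.length)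
    (h : A.pt 0 ∈ segment ℝ (A.pt i) (A.pt (i + 1))) : i = 0 := by
  by_contra h0
  obtain ⟨h1, h2⟩ := A.simple 0 i (by omega) hi _ (left_mem_segment ℝ _ _) h
  subst h1
  exact A.pt_ne 0 A.length_pos h2

theorem succ_eq_length_of_pt_length_mem (A : PolygonalArc) {i : ℕ} (hi : i < A.length)
    (h : A.pt A.length ∈ segment ℝ (A.pt i) (A.pt (i + 1))) : i + 1 = A.length := by
  by_contra h0
  obtain ⟨k, hk⟩ : ∃ k, A.length = k + 1 := ⟨A.length - 1, by omega⟩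
  rw [hk] at h
  obtain ⟨h1, h2⟩ := A.simple i k (by omega) (by omega) _ h (right_mem_segment ℝ _ _)
  exact A.pt_ne k (by omega) h2.symm

/-- A telescoping sum mod 2: inner breakpoints are counted twice. -/
theorem sum_ends [DecidableEq (ℝ × ℝ)] (A : PolygonalArc) (p : ℝ × ℝ) :
    ∑ i : Fin A.length, ((if A.pt i = p then 1 else 0) +
      (if A.pt (i + 1) = p then 1 else 0) : ZMod 2) =
      (if A.pt 0 = p then 1 else 0) + (if A.pt A.length = p then 1 else 0) := by
  rw [Fin.sum_univ_eq_sum_range fun i => ((if A.pt i = p then 1 else 0) +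
    (if A.pt (i + 1) = p then 1 else 0) : ZMod 2)]
  have := Finset.sum_range_sub (fun i => (if A.pt i = p then 1 else 0 : ZMod 2)) A.length
  simp only [CharTwo.sub_eq_add] at this
  rw [add_comm (if A.pt 0 = p then 1 else 0 : ZMod 2), ← this]
  exact Finset.sum_congr rfl fun _ _ => add_comm _ _

end PolygonalArc

namespace SimpleGraph

variable {V : Type*}

open Classical in
/-- The boundary map on sets of edges, over the field with two elements. -/
noncomputable def boundary [Fintype V] (G : SimpleGraph V) :
    (G.edgeSet → ZMod 2) →ₗ[ZMod 2] (V → ZMod 2) :=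
  ∑ e : G.edgeSet, (LinearMap.proj e).smulRight (fun v => if v ∈ (e : Sym2 V) then 1 else 0)

open Classical in
theorem boundary_apply [Fintype V] (G : SimpleGraph V) (z : G.edgeSet → ZMod 2) (v : V) :
    G.boundary z v = ∑ e : G.edgeSet, (if v ∈ (e : Sym2 V) then 1 else 0) * z e := by
  simp [boundary, Finset.sum_apply, LinearMap.sum_apply, mul_comm]

namespace PlaneDrawing

variable {G : SimpleGraph V} (D : PlaneDrawing G)

theorem pos_eq_end {e : G.edgeSet} {v : V} (hv : v ∈ (e : Sym2 V)) :
    D.pos v = (D.arc e).pt 0 ∨ D.pos v = (D.arc e).pt (D.arc e).length := by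
  have h := D.arc_ends e
  have h1 : D.pos v ∈ Sym2.map D.pos (e : Sym2 V) := Sym2.mem_map.2 ⟨v, hv, rfl⟩
  rw [← h, PolygonalArc.ends, Sym2.mem_iff] at h1
  exact h1

theorem exists_pos_eq_of_mem_ends {e : G.edgeSet} {p : ℝ × ℝ} (h : p ∈ (D.arc e).ends) :
    ∃ v ∈ (e : Sym2 V), D.pos v = p := by
  rw [D.arc_ends e, Sym2.mem_map] at h
  exact h

theorem pt_zero_ne_pt_length (e : G.edgeSet) : (D.arc e).pt 0 ≠ (D.arc e).pt (D.arc e).length := by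
  intro h
  have h1 := D.arc_ends e
  have h2 := G.not_isDiag_of_mem_edgeSet e.2
  have h3 : (Sym2.map D.pos (e : Sym2 V)).IsDiag := by
    rw [← h1, PolygonalArc.ends, h]; exact Sym2.diag_isDiag _
  generalize (e : Sym2 V) = x at h2 h3
  induction x with
  | _ u v => exact h2 (D.pos_injective h3)

open Classical in
theorem ends_indicator (e : G.edgeSet) (v : V) :
    ((if (D.arc e).pt 0 = D.pos v then 1 else 0) +
      (if (D.arc e).pt (D.arc e).length = D.pos v then 1 else 0) : ZMod 2) =
      if v ∈ (e : Sym2 V) then 1 else 0 := by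
  have hne := D.pt_zero_ne_pt_length e
  by_cases hv : v ∈ (e : Sym2 V)
  · rcases D.pos_eq_end hv with h | h
    · simp [hv, h, hne.symm]
    · simp [hv, h, hne]
  · have key : ∀ p, p ∈ (D.arc e).ends → p ≠ D.pos v := by
      intro p hp h
      obtain ⟨w, hw, h'⟩ := D.exists_pos_eq_of_mem_ends hp
      exact hv (D.pos_injective (h'.trans h) ▸ hw)
    rw [if_neg (key _ (Sym2.mem_mk_left _ _)), if_neg (key _ (Sym2.mem_mk_right _ _)), if_neg hv,
      add_zero]

/-- Different arcs meet only in vertices, and a vertex of `e` is an end of its arc, which simplicity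
confines to the first or last segment. Hence inner breakpoints belong to a single arc. -/
theorem end_of_mem_of_mem {e e' : G.edgeSet} (hne : e ≠ e') {i j : ℕ} (hi : i < (D.arc e).length)
    (hj : j < (D.arc e').length) {x : ℝ × ℝ}
    (hx : x ∈ segment ℝ ((D.arc e).pt i) ((D.arc e).pt (i + 1)))
    (hx' : x ∈ segment ℝ ((D.arc e').pt j) ((D.arc e').pt (j + 1))) :
    (i = 0 ∧ x = (D.arc e).pt 0) ∨
      (i + 1 = (D.arc e).length ∧ x = (D.arc e).pt (D.arc e).length) := by
  obtain ⟨v, hv, -, rfl⟩ := D.arc_inter_arc e e' hne x ⟨i, hi, hx⟩ ⟨j, hj, hx'⟩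
  rcases D.pos_eq_end hv with h | h
  · rw [h] at hx
    exact .inl ⟨(D.arc e).eq_zero_of_pt_zero_mem hi hx, h⟩
  · rw [h] at hx
    exact .inr ⟨(D.arc e).succ_eq_length_of_pt_length_mem hi hx, h⟩

open Classical in
/-- The cycle space of a plane graph is generated by a family (the face boundaries) in which every
edge occurs at most twice. -/
theorem exists_faces {V : Type u} {G : SimpleGraph V} [Fintype V] (D : PlaneDrawing G) :
    ∃ (F : Type u) (_ : Fintype F) (b : F → G.edgeSet → ZMod 2), (∀ f, G.boundary (b f) = 0) ∧
      (∀ e, Set.ncard {f | b f e ≠ 0} ≤ 2) ∧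
      ∀ z, G.boundary z = 0 → ∃ c : F → ZMod 2, z = ∑ f, c f • b f := by
  let S := Σ e : G.edgeSet, Fin (D.arc e).length
  let a : S → ℝ × ℝ := fun s => (D.arc s.1).pt s.2
  let b : S → ℝ × ℝ := fun s => (D.arc s.1).pt (s.2 + 1)
  have hab : ∀ s, a s ≠ b s := fun s => (D.arc s.1).pt_ne _ s.2.2
  have hint : ∀ s t, s ≠ t → ∀ x, x ∈ segment ℝ (a s) (b s) → x ∈ segment ℝ (a t) (b t) →
      (x = a s ∨ x = b s) := by
    rintro ⟨e, i⟩ ⟨e', j⟩ hst x hx hx'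
    by_cases he : e = e'
    · subst he
      have hij : (i : ℕ) ≠ j := fun h => hst (by rw [Fin.ext h])
      rcases lt_or_gt_of_ne hij with h | h
      · obtain ⟨h1, h2⟩ := (D.arc e).simple i j h j.2 x hx hx'
        exact .inr (by rw [h2, h1])
      · exact .inl ((D.arc e).simple j i h i.2 x hx' hx).2
    · rcases D.end_of_mem_of_mem he i.2 j.2 hx hx' with ⟨h1, h2⟩ | ⟨h1, h2⟩
      · exact .inl (by simp only [a, h1, h2])
      · exact .inr (by simp only [b, h1, h2])
  obtain ⟨F, hF, y, h1, h2, h3⟩ := exists_faces_of_segments a b hab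
    fun s t hst x hx hx' => ⟨hint s t hst x hx hx', hint t s hst.symm x hx' hx⟩
  have hpos : ∀ e, 0 < (D.arc e).length := fun e => (D.arc e).length_pos
  -- An inner breakpoint is an end of exactly two segments, so evenness there forces an even set to
  -- contain both or neither. Even sets of segments thus come from sets of edges.
  have hconst : ∀ f e (i : ℕ) (hi : i < (D.arc e).length), y f ⟨e, i, hi⟩ = y f ⟨e, 0, hpos e⟩ := by
    intro f e i
    induction i with
    | zero => intro _; rfl
    | succ i ih =>
      intro hi
      rw [← ih (by omega)]
      have h := h1 f ((D.arc e).pt (i + 1))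
      have hne : (⟨e, ⟨i, by omega⟩⟩ : S) ≠ ⟨e, ⟨i + 1, hi⟩⟩ := by simp
      rw [← Finset.sum_subset (Finset.subset_univ
        {(⟨e, ⟨i, by omega⟩⟩ : S), ⟨e, ⟨i + 1, hi⟩⟩}), Finset.sum_pair hne] at h
      · have g1 := (D.arc e).pt_ne i (by omega)
        have g2 := (D.arc e).pt_ne (i + 1) hi
        simp only [a, b, if_neg g1, if_neg g2.symm, if_true, zero_add, add_zero, one_mul] at h
        rw [← sub_eq_zero, CharTwo.sub_eq_add, add_comm]
        exact h
      · rintro ⟨e', j⟩ - hs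
        have hj : ¬ (a ⟨e', j⟩ = (D.arc e).pt (i + 1) ∨ b ⟨e', j⟩ = (D.arc e).pt (i + 1)) := by
          intro hj
          have hmem : (D.arc e).pt (i + 1) ∈
              segment ℝ ((D.arc e').pt j) ((D.arc e').pt (j + 1)) := by
            rcases hj with hj | hj
            · rw [← hj]; exact left_mem_segment ℝ _ _
            · rw [← hj]; exact right_mem_segment ℝ _ _
          have m1 := right_mem_segment ℝ ((D.arc e).pt i) ((D.arc e).pt (i + 1))
          have m2 := left_mem_segment ℝ ((D.arc e).pt (i + 1)) ((D.arc e).pt (i + 1 + 1))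
          by_cases he : e' = e
          · subst he
            apply hs
            have : (j : ℕ) = i ∨ (j : ℕ) = i + 1 := by
              by_contra hcon
              push Not at hcon
              rcases lt_or_gt_of_ne hcon.1 with h | h
              · have := ((D.arc e').simple j (i + 1) (by omega) hi _ hmem m2).1
                omega
              · have := ((D.arc e').simple i j h j.2 _ m1 hmem).1
                omega
            rcases this with h | h
            · obtain rfl : j = ⟨i, Nat.lt_of_succ_lt hi⟩ := Fin.ext h
              simp
            · obtain rfl : j = ⟨i + 1, hi⟩ := Fin.ext h
              simp
          · have k1 := D.end_of_mem_of_mem (Ne.symm he) (by omega) j.2 m1 hmem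
            have k2 := D.end_of_mem_of_mem (Ne.symm he) hi j.2 m2 hmem
            rcases k2 with k2 | k2
            · omega
            · rcases k1 with ⟨-, k1⟩ | ⟨k1, -⟩
              · exact D.pt_zero_ne_pt_length e (k1.symm.trans k2.2)
              · omega
        rw [not_or] at hj
        rw [if_neg hj.1, if_neg hj.2, add_zero, zero_mul]
  have hlift : ∀ (z : G.edgeSet → ZMod 2) p,
      ∑ s : S, ((if a s = p then 1 else 0) + (if b s = p then 1 else 0)) * z s.1 =
      ∑ e, ((if (D.arc e).pt 0 = p then 1 else 0) +
        (if (D.arc e).pt (D.arc e).length = p then 1 else 0)) * z e := by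
    intro z p
    rw [Fintype.sum_sigma]
    refine Finset.sum_congr rfl fun e _ => ?_
    rw [← (D.arc e).sum_ends p, Finset.sum_mul]
  refine ⟨F, hF, fun f e => y f ⟨e, 0, hpos e⟩, fun f => ?_, fun e => h2 _, fun z hz => ?_⟩
  · ext v
    rw [boundary_apply]
    simp only [← D.ends_indicator]
    rw [← hlift fun e => y f ⟨e, 0, hpos e⟩]
    refine Eq.trans (Finset.sum_congr rfl ?_) (h1 f (D.pos v))
    rintro ⟨e, i⟩ -
    rw [hconst f e i i.2]
  · obtain ⟨c, hc⟩ := h3 (fun s => z s.1) fun p => by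
      rw [hlift]
      by_cases hp : ∃ v, D.pos v = p
      · obtain ⟨v, rfl⟩ := hp
        simp only [D.ends_indicator]
        rw [← boundary_apply, hz]; rfl
      · refine Finset.sum_eq_zero fun e _ => ?_
        have key : ∀ q, q ∈ (D.arc e).ends → q ≠ p := by
          rintro q hq rfl
          obtain ⟨w, -, h'⟩ := D.exists_pos_eq_of_mem_ends hq
          exact hp ⟨w, h'⟩
        rw [if_neg (key _ (Sym2.mem_mk_left _ _)), if_neg (key _ (Sym2.mem_mk_right _ _)),
          add_zero, zero_mul]
    refine ⟨c, ?_⟩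
    ext e
    have := congrFun hc ⟨e, 0, hpos e⟩
    simpa [Finset.sum_apply] using this

end PlaneDrawing

end SimpleGraph

/-! ### Euler's inequality through the cycle space -/

/-- If every coordinate is nonzero in at most two vectors of the linearly independent set `t`, and
every nonzero vector of a subspace containing `t` has weight at least `3`, then
`3 * (#t + 1) ≤ 2 * #E`. -/
theorem three_mul_card_add_one_le {E : Type*} [Fintype E] [DecidableEq E]
    (t : Finset (E → ZMod 2)) (ht : t.Nonempty)
    (hli : LinearIndependent (ZMod 2) (fun x : {x // x ∈ (t : Set (E → ZMod 2))} => x.1))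
    (h2 : ∀ e, (t.filter fun x => x e ≠ 0).card ≤ 2)
    (Z : Submodule (ZMod 2) (E → ZMod 2)) (htZ : ∀ x ∈ t, x ∈ Z)
    (h3 : ∀ x ∈ Z, x ≠ 0 → 3 ≤ (Finset.univ.filter fun e => x e ≠ 0).card) :
    3 * (t.card + 1) ≤ 2 * Fintype.card E := by
  have hb0 : ∑ x ∈ t, x ≠ 0 := by
    intro h0
    obtain ⟨x, hx⟩ := ht
    have h1 := linearIndependent_iff'.1 hli Finset.univ (fun _ => 1) (by
      simp only [one_smul]
      rw [← h0]
      exact (Finset.sum_subtype t (fun x => by simp) fun x => x).symm) ⟨x, hx⟩ (Finset.mem_univ _)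
    exact one_ne_zero h1
  have e0 : ∀ a : ZMod 2, a ≠ 0 ↔ a = 1 := by decide
  -- The sum of `t` plays the outer face. It is nonzero at a coordinate only if an odd number of
  -- vectors are, so it never raises the count above two.
  have hone : ∀ e, (t.filter fun x => x e ≠ 0).card +
      (if (∑ x ∈ t, x) e ≠ 0 then 1 else 0) ≤ 2 := by
    intro e
    have hc : (∑ x ∈ t, x) e = ((t.filter fun x => x e ≠ 0).card : ZMod 2) := by
      rw [Finset.sum_apply, Finset.card_filter, Nat.cast_sum]
      refine Finset.sum_congr rfl fun x _ => ?_
      by_cases hx : x e = 0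
      · simp [hx]
      · simp [(e0 _).1 hx]
    rw [hc]
    have h := h2 e
    generalize (t.filter fun x => x e ≠ 0).card = k at h
    interval_cases k <;> decide
  have hsum := Finset.sum_le_sum fun e (_ : e ∈ (Finset.univ : Finset E)) => hone e
  rw [Finset.sum_add_distrib, ← Finset.card_filter, Finset.sum_const, smul_eq_mul,
    Finset.card_univ] at hsum
  have hdc : ∑ e, (t.filter fun x => x e ≠ 0).card =
      ∑ x ∈ t, (Finset.univ.filter fun e => x e ≠ 0).card := by
    simp only [Finset.card_filter]
    exact Finset.sum_comm
  have hl : t.card * 3 ≤ ∑ x ∈ t, (Finset.univ.filter fun e => x e ≠ 0).card := by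
    rw [← smul_eq_mul]
    refine Finset.card_nsmul_le_sum _ _ _ fun x hx => h3 x (htZ x hx) ?_
    rintro rfl
    exact hli.ne_zero ⟨0, hx⟩ rfl
  have hl0 := h3 (∑ x ∈ t, x) (Submodule.sum_mem _ htZ) hb0
  omega

namespace SimpleGraph

variable {V : Type u} [Fintype V] {G F : SimpleGraph V}

open Classical in
/-- A nonempty even set of edges has at least three elements. -/
theorem three_le_card_of_boundary_eq_zero {z : G.edgeSet → ZMod 2} (hz : G.boundary z = 0)
    (h0 : z ≠ 0) : 3 ≤ (Finset.univ.filter fun e => z e ≠ 0).card := by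
  have other : ∀ e, z e ≠ 0 → ∀ v ∈ (e : Sym2 V), ∃ e' ≠ e, v ∈ (e' : Sym2 V) ∧ z e' ≠ 0 := by
    intro e he v hv
    by_contra hcon
    push Not at hcon
    have h := congrFun hz v
    rw [boundary_apply, Finset.sum_eq_single e, if_pos hv, one_mul] at h
    · exact he h
    · intro e' _ hne
      by_cases hv' : v ∈ (e' : Sym2 V)
      · rw [hcon e' hne hv', mul_zero]
      · rw [if_neg hv', zero_mul]
    · simp
  obtain ⟨⟨e, hG⟩, he⟩ := Function.ne_iff.1 h0
  induction e with
  | _ u v =>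
  have huv : u ≠ v := hG.ne
  obtain ⟨e₁, hne₁, hu₁, hz₁⟩ := other _ he u (Sym2.mem_mk_left _ _)
  obtain ⟨e₂, hne₂, hv₂, hz₂⟩ := other _ he v (Sym2.mem_mk_right _ _)
  -- Only the edge `uv` itself contains both `u` and `v`, so the further edges forced at `u` and at
  -- `v` differ.
  have h12 : e₁ ≠ e₂ := by
    rintro rfl
    exact hne₁ (Subtype.ext ((Sym2.mem_and_mem_iff huv).1 ⟨hu₁, hv₂⟩))
  rw [← Finset.card_eq_three.2 ⟨_, _, _, hne₁.symm, hne₂.symm, h12, rfl⟩]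
  refine Finset.card_le_card fun x hx => ?_
  simp only [Finset.mem_insert, Finset.mem_singleton] at hx
  rw [Finset.mem_filter]
  rcases hx with rfl | rfl | rfl
  exacts [⟨Finset.mem_univ _, he⟩, ⟨Finset.mem_univ _, hz₁⟩, ⟨Finset.mem_univ _, hz₂⟩]

-- Along a walk in `F` the boundaries of its edges telescope to the sum of the two ends. Hence the
-- boundary of each edge of `G` is in the span of the boundaries of the edges of `F`.
open Classical in
theorem finrank_range_boundary_le (hr : F.Reachable = G.Reachable) :
    Module.finrank (ZMod 2) (LinearMap.range G.boundary) ≤ F.edgeSet.ncard := by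
  let g : Sym2 V → V → ZMod 2 := fun e v => if v ∈ e then 1 else 0
  let W := Submodule.span (ZMod 2) (g '' F.edgeSet)
  have hW : Module.finrank (ZMod 2) W ≤ F.edgeSet.ncard := by
    have hfin : (g '' F.edgeSet).Finite := Set.toFinite _
    have h := finrank_span_le_card (R := ZMod 2) (g '' F.edgeSet)
    rw [← Set.ncard_eq_toFinset_card'] at h
    exact h.trans (Set.ncard_image_le (Set.toFinite _))
  have hg : ∀ u v, u ≠ v → g s(u, v) = Pi.single u 1 + Pi.single v 1 := by
    intro u v huv
    ext w
    by_cases h1 : w = u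
    · subst h1; simp [g, huv]
    · by_cases h2 : w = v
      · subst h2; simp [g, h1]
      · simp [g, h1, h2]
  have hadd : ∀ x : V → ZMod 2, x + x = 0 := fun x => funext fun v => CharTwo.add_self_eq_zero _
  have hwalk : ∀ u v, F.Reachable u v →
      (Pi.single u 1 + Pi.single v 1 : V → ZMod 2) ∈ W := by
    rintro u v ⟨p⟩
    induction p with
    | nil => rw [hadd]; exact W.zero_mem
    | @cons u v w huv p ih =>
      have h1 : g s(u, v) ∈ W := Submodule.subset_span ⟨_, huv, rfl⟩
      rw [hg u v huv.ne] at h1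
      have := W.add_mem h1 ih
      rwa [add_assoc, ← add_assoc (Pi.single v 1), hadd, zero_add] at this
  have hle : LinearMap.range G.boundary ≤ W := by
    rintro _ ⟨z, rfl⟩
    have : G.boundary z = ∑ e : G.edgeSet, z e • g e := by
      ext v
      simp [boundary_apply, g, Finset.sum_apply]
    rw [this]
    refine Submodule.sum_mem _ fun e _ => W.smul_mem _ ?_
    obtain ⟨e, he⟩ := e
    induction e with
    | _ u v =>
    have huv : G.Adj u v := he
    rw [hg u v huv.ne]
    exact hwalk u v (by rw [hr]; exact huv.reachable)
  exact (Submodule.finrank_mono hle).trans hW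

/-- Euler's inequality: a planar graph with a spanning forest of `r` edges has at most `3 * r - 3`
edges, unless it is a forest itself. -/
theorem IsPlanar.ncard_edgeSet_le (hG : G.IsPlanar) (hr : F.Reachable = G.Reachable) :
    G.edgeSet.ncard + 3 ≤ 3 * F.edgeSet.ncard ∨ G.edgeSet.ncard ≤ F.edgeSet.ncard := by
  classical
  obtain ⟨D⟩ := hG
  obtain ⟨ι, _, b, hb, h2, hspan⟩ := D.exists_faces
  have hrank := finrank_range_boundary_le hr
  have hrn := LinearMap.finrank_range_add_finrank_ker G.boundary
  have hcard : Module.finrank (ZMod 2) (G.edgeSet → ZMod 2) = G.edgeSet.ncard := by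
    rw [Module.finrank_fintype_fun_eq_card, Set.ncard_eq_toFinset_card', Set.toFinset_card]
  have hcard' : Fintype.card G.edgeSet = G.edgeSet.ncard := by
    rw [Set.ncard_eq_toFinset_card', Set.toFinset_card]
  rw [hcard] at hrn
  -- The facial walks may be dependent, so a basis is selected among them; this keeps the bound of
  -- two walks per edge.
  obtain ⟨t, htb, hts, hli⟩ := exists_linearIndependent (ZMod 2) (Set.range b)
  have htfin : t.Finite := (Set.finite_range b).subset htb
  obtain ⟨t, rfl⟩ := htfin.exists_finset_coe
  have hker : LinearMap.ker G.boundary =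
      Submodule.span (ZMod 2) (t : Set (G.edgeSet → ZMod 2)) := by
    rw [hts]
    apply le_antisymm
    · intro z hz
      obtain ⟨c, rfl⟩ := hspan z hz
      exact Submodule.sum_mem _ fun f _ => Submodule.smul_mem _ _ (Submodule.subset_span ⟨f, rfl⟩)
    · rw [Submodule.span_le]
      rintro _ ⟨f, rfl⟩
      exact hb f
  have hdim : Module.finrank (ZMod 2) (LinearMap.ker G.boundary) = t.card := by
    rw [hker]
    exact finrank_span_finset_eq_card hli
  rcases t.eq_empty_or_nonempty with rfl | hne
  · right
    rw [Finset.card_empty] at hdim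
    omega
  · left
    have := three_mul_card_add_one_le t hne hli (fun e => ?_) (LinearMap.ker G.boundary)
      (fun x hx => by rw [hker]; exact Submodule.subset_span hx)
      fun x hx h0 => three_le_card_of_boundary_eq_zero hx h0
    · omega
    · refine le_trans ?_ (h2 e)
      refine le_trans ?_ (Set.ncard_image_le (f := b) (Set.toFinite _))
      rw [← Set.ncard_coe_finset]
      refine Set.ncard_le_ncard ?_ (Set.toFinite _)
      intro x hx
      rw [Finset.mem_coe, Finset.mem_filter] at hx
      obtain ⟨f, rfl⟩ := htb hx.1
      exact ⟨f, hx.2, rfl⟩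

end SimpleGraph

/-! ### Colour classes and the exchange of tree edges -/

namespace SimpleGraph

/-- A subgraph of a planar graph is planar. -/
theorem IsPlanar.mono {V : Type*} {G H : SimpleGraph V} (hHG : H ≤ G) (hG : G.IsPlanar) :
    H.IsPlanar := by
  obtain ⟨D⟩ := hG
  have hsub : ∀ e : H.edgeSet, (e : Sym2 V) ∈ G.edgeSet := fun e => edgeSet_mono hHG e.2
  exact ⟨{
    pos := D.pos
    pos_injective := D.pos_injective
    arc := fun e => D.arc ⟨e, hsub e⟩
    arc_ends := fun e => D.arc_ends ⟨e, hsub e⟩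
    vertex_mem_arc := fun e => D.vertex_mem_arc ⟨e, hsub e⟩
    arc_inter_arc := fun e e' hne => D.arc_inter_arc ⟨e, hsub e⟩ ⟨e', hsub e'⟩ fun h =>
      hne (Subtype.ext (Subtype.mk_eq_mk.1 h)) }⟩

/-- The spanning subgraph of `G` formed by the edges of colour `c`. -/
def colourClass {V : Type*} (G : SimpleGraph V) (f : Sym2 V → ℤ) (c : ℤ) : SimpleGraph V :=
  fromEdgeSet {e ∈ G.edgeSet | f e = c}

theorem edgeSet_colourClass {V : Type*} (G : SimpleGraph V) (f : Sym2 V → ℤ) (c : ℤ) :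
    (G.colourClass f c).edgeSet = {e ∈ G.edgeSet | f e = c} := by
  rw [colourClass, edgeSet_fromEdgeSet, sdiff_eq_left]
  exact Set.disjoint_left.2 fun e he => G.not_isDiag_of_mem_edgeSet he.1

theorem colourClass_le {V : Type*} (G : SimpleGraph V) (f : Sym2 V → ℤ) (c : ℤ) :
    G.colourClass f c ≤ G := by
  rw [← edgeSet_subset_edgeSet, edgeSet_colourClass]
  exact Set.sep_subset _ _

variable {V : Type u} [Fintype V]

theorem ncard_edgeSet_colourClass (G : SimpleGraph V) (f : Sym2 V → ℤ) (c : ℤ) :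
    (G.colourClass f c).edgeSet.ncard = G.colourCount f c := by
  classical
  rw [edgeSet_colourClass, colourCount, ← Set.ncard_coe_finset]
  congr 1
  ext e
  simp

theorem weight_eq {T : SimpleGraph V} {f : Sym2 V → ℤ} (hf : T.IsSignColouring f) :
    T.weight f = T.edgeSet.ncard - 2 * (T.edgeSet ∩ {e | f e = -1}).ncard := by
  classical
  have h1 : T.edgeSet.ncard = T.edgeFinset.card := by
    rw [← Set.ncard_coe_finset, coe_edgeFinset]
  have h2 : (T.edgeSet ∩ {e | f e = -1}).ncard = (T.edgeFinset.filter fun e => f e = -1).card := by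
    rw [← Set.ncard_coe_finset]
    congr 1
    ext e
    simp
  rw [weight, h1, h2, Finset.card_eq_sum_ones, Finset.card_filter]
  push_cast
  rw [Finset.mul_sum, ← Finset.sum_sub_distrib]
  refine Finset.sum_congr (by congr) fun e he => ?_
  rcases hf e (mem_edgeFinset.1 he) with h | h <;> simp [h]

theorem IsTree.ncard_edgeSet {T : SimpleGraph V} (hT : T.IsTree) :
    T.edgeSet.ncard + 1 = Fintype.card V := by
  classical
  rw [← hT.card_edgeFinset, ← Set.ncard_coe_finset, coe_edgeFinset]

/-- If a connected graph is the edge-disjoint union of `R` and `B`, and all spanning forests of `R`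
and of `B` have at least `k` edges, then there is a spanning tree with at least `k` edges in each
of `R` and `B`. -/
theorem Connected.exists_isTree_le_ncard_inter {G R B : SimpleGraph V} (hG : G.Connected)
    (hR : R ≤ G) (hB : B ≤ G) (hRB : G ≤ R ⊔ B) (hdisj : Disjoint R.edgeSet B.edgeSet) {k : ℕ}
    (hk : 2 * k + 1 ≤ Fintype.card V)
    (hRk : ∀ F : SimpleGraph V, F.Reachable = R.Reachable → k ≤ F.edgeSet.ncard)
    (hBk : ∀ F : SimpleGraph V, F.Reachable = B.Reachable → k ≤ F.edgeSet.ncard) :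
    ∃ T ≤ G, T.IsTree ∧ k ≤ (T.edgeSet ∩ R.edgeSet).ncard ∧
      (T.edgeSet ∩ R.edgeSet).ncard + k + 1 ≤ Fintype.card V := by
  -- A tree containing a spanning forest of `B` has enough edges in `B`; only its edges in `R` may
  -- be too few.
  obtain ⟨F, hFB, hF, hFr⟩ := B.exists_isAcyclic_reachable_eq_le
  obtain ⟨T, hFT, hTG, hT⟩ := hG.exists_isTree_le_of_le_of_isAcyclic (hFB.trans hB) hF
  have hcard := hT.ncard_edgeSet
  have hq : (T.edgeSet ∩ R.edgeSet).ncard + k ≤ T.edgeSet.ncard := by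
    have h1 : Disjoint (T.edgeSet ∩ R.edgeSet) F.edgeSet :=
      (hdisj.mono_right (edgeSet_mono hFB)).mono_left Set.inter_subset_right
    have h2 := Set.ncard_union_eq h1 (Set.toFinite _) (Set.toFinite _)
    have h3 := Set.ncard_le_ncard
      (Set.union_subset (Set.inter_subset_left (s := T.edgeSet) (t := R.edgeSet))
        (edgeSet_mono hFT)) (Set.toFinite _)
    have := hBk F hFr
    omega
  by_cases hkq : k ≤ (T.edgeSet ∩ R.edgeSet).ncard
  · exact ⟨T, hTG, hT, hkq, by omega⟩
  obtain ⟨F', hF'1, hF'R, hF', hF'r⟩ := R.exists_isAcyclic_reachable_eq_le_of_le_of_isAcyclic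
    (H := T ⊓ R) inf_le_right (hT.isAcyclic.anti inf_le_left)
  have hsub : T.edgeSet ∩ R.edgeSet ⊆ F'.edgeSet := by
    rw [← edgeSet_inf]; exact edgeSet_mono hF'1
  -- `E` is acyclic, contains the `R`-edges of `T` and has exactly `k` elements. As `T` lies in the
  -- union of `E` and `B`, that union is connected, and a spanning tree of it containing `E` has
  -- exactly `k` edges in `R`.
  obtain ⟨E, hE1, hE2, hEk⟩ := Set.exists_subsuperset_card_eq hsub (not_le.1 hkq).le (hRk F' hF'r)
  have hEset : (fromEdgeSet E).edgeSet = E := by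
    rw [edgeSet_fromEdgeSet, sdiff_eq_left]
    exact Set.disjoint_left.2 fun e he => F'.not_isDiag_of_mem_edgeSet (hE2 he)
  have hEF : fromEdgeSet E ≤ F' := by
    rw [← edgeSet_subset_edgeSet, hEset]; exact hE2
  have hTE : T ≤ fromEdgeSet E ⊔ B := by
    rw [← edgeSet_subset_edgeSet, edgeSet_sup, hEset]
    intro e he
    have : e ∈ (R ⊔ B).edgeSet := edgeSet_mono (hTG.trans hRB) he
    rw [edgeSet_sup] at this
    exact this.imp (fun h => hE1 ⟨he, h⟩) id
  obtain ⟨T', hET', hT'1, hT'⟩ := (hT.connected.mono hTE).exists_isTree_le_of_le_of_isAcyclic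
    le_sup_left (hF'.anti hEF)
  have hT'R : T'.edgeSet ∩ R.edgeSet = E := by
    apply Set.Subset.antisymm
    · rintro e ⟨he, heR⟩
      have := edgeSet_mono hT'1 he
      rw [edgeSet_sup, hEset] at this
      exact this.resolve_right fun h => Set.disjoint_left.1 hdisj heR h
    · intro e he
      refine ⟨edgeSet_mono hET' (by rwa [hEset]), edgeSet_mono hF'R (hE2 he)⟩
  refine ⟨T', hT'1.trans (sup_le ((hEF.trans hF'R).trans hR) hB), hT', ?_, ?_⟩ <;> rw [hT'R] <;>
    omega

/-- With `n ≥ 7` one has `k ≥ 3`, so the subtraction of `5` is not truncated and the forest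
alternative of Euler's inequality, at most `k - 1 ≤ 3k - 6` edges, is excluded as well. Maximality
is needed only for connectedness, which is assumed here. -/
theorem IsPlanar.hasBalancedSpanningTree {G : SimpleGraph V} (hG : G.IsPlanar)
    (hconn : G.Connected) (hn : 7 ≤ Fintype.card V) {f : Sym2 V → ℤ} (hf : G.IsSignColouring f)
    (hmin : 3 * ((Fintype.card V - 1) / 2) - 5 ≤ min (G.colourCount f (-1)) (G.colourCount f 1)) :
    G.HasBalancedSpanningTree f := by
  have hforest : ∀ c, 3 * ((Fintype.card V - 1) / 2) - 5 ≤ G.colourCount f c →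
      ∀ F : SimpleGraph V, F.Reachable = (G.colourClass f c).Reachable →
        (Fintype.card V - 1) / 2 ≤ F.edgeSet.ncard := by
    intro c hc F hF
    have h := (hG.mono (G.colourClass_le f c)).ncard_edgeSet_le hF
    rw [ncard_edgeSet_colourClass] at h
    omega
  obtain ⟨h1, h2⟩ := le_min_iff.1 hmin
  have hdisj : Disjoint (G.colourClass f (-1)).edgeSet (G.colourClass f 1).edgeSet := by
    rw [edgeSet_colourClass, edgeSet_colourClass, Set.disjoint_left]
    rintro e ⟨-, h3⟩ ⟨-, h4⟩
    rw [h3] at h4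
    norm_num at h4
  have hsup : G ≤ G.colourClass f (-1) ⊔ G.colourClass f 1 := by
    rw [← edgeSet_subset_edgeSet, edgeSet_sup, edgeSet_colourClass, edgeSet_colourClass]
    exact fun e he => (hf e he).imp (fun h => ⟨he, h⟩) fun h => ⟨he, h⟩
  obtain ⟨T, hTG, hT, h3, h4⟩ := hconn.exists_isTree_le_ncard_inter (G.colourClass_le f (-1))
    (G.colourClass_le f 1) hsup hdisj (by omega) (hforest _ h1) (hforest _ h2)
  refine ⟨T, hTG, hT, ?_⟩
  have hTR : T.edgeSet ∩ (G.colourClass f (-1)).edgeSet = T.edgeSet ∩ {e | f e = -1} := by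
    rw [edgeSet_colourClass]
    ext e
    exact ⟨fun h => ⟨h.1, h.2.2⟩, fun h => ⟨h.1, edgeSet_mono hTG h.1, h.2⟩⟩
  rw [hTR] at h3 h4
  have hw := weight_eq (T := T) (f := f) fun e he => hf e (edgeSet_mono hTG he)
  have hcard := hT.ncard_edgeSet
  rw [abs_eq one_pos.le]
  omega

end SimpleGraph

/-! ### Sharpness: the double fan -/

namespace SimpleGraph

/-- The arc formed by a single segment. -/
def segmentArc (p q : ℝ × ℝ) (h : p ≠ q) : PolygonalArc where
  length := 1
  pt i := if i = 0 then p else q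
  length_pos := one_pos
  pt_ne i hi := by
    obtain rfl : i = 0 := by omega
    simpa using h
  simple i j hij hj := by omega

theorem mem_carrier_segmentArc {p q : ℝ × ℝ} (h : p ≠ q) (x : ℝ × ℝ) :
    x ∈ (segmentArc p q h).carrier ↔ x ∈ segment ℝ p q := by
  constructor
  · rintro ⟨i, hi, hx⟩
    obtain rfl : i = 0 := Nat.lt_one_iff.1 hi
    simpa [segmentArc] using hx
  · intro hx
    exact ⟨0, one_pos, by simpa [segmentArc] using hx⟩

/-- A graph is planar if it has a straight line drawing. -/
theorem isPlanar_of_segments {V : Type*} [LinearOrder V] {G : SimpleGraph V} (pos : V → ℝ × ℝ)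
    (hpos : Function.Injective pos)
    (hv : ∀ u v w, u < v → G.Adj u v → pos w ∈ segment ℝ (pos u) (pos v) → w = u ∨ w = v)
    (hc : ∀ u v u' v', u < v → u' < v' → G.Adj u v → G.Adj u' v' → (u ≠ u' ∨ v ≠ v') →
      ∀ x, x ∈ segment ℝ (pos u) (pos v) → x ∈ segment ℝ (pos u') (pos v') →
      ∃ w, (w = u ∨ w = v) ∧ (w = u' ∨ w = v') ∧ x = pos w) : G.IsPlanar := by
  have hex : ∀ e : G.edgeSet, ∃ p : V × V, p.1 < p.2 ∧ (e : Sym2 V) = s(p.1, p.2) := by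
    rintro ⟨e, he⟩
    induction e with
    | _ u v =>
    rcases lt_or_gt_of_ne (show u ≠ v from G.ne_of_adj he) with h | h
    · exact ⟨(u, v), h, rfl⟩
    · exact ⟨(v, u), h, Sym2.eq_swap⟩
  choose p hlt hp using hex
  have hadj : ∀ e : G.edgeSet, G.Adj (p e).1 (p e).2 := fun e => by
    rw [← mem_edgeSet, ← hp]; exact e.2
  have hne : ∀ e, pos (p e).1 ≠ pos (p e).2 := fun e h => (hlt e).ne (hpos h)
  exact ⟨{
    pos := pos
    pos_injective := hpos
    arc := fun e => segmentArc _ _ (hne e)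
    arc_ends := fun e => by rw [hp e]; rfl
    vertex_mem_arc := fun e v h => by
      rw [mem_carrier_segmentArc] at h
      rw [hp e, Sym2.mem_iff]
      exact hv _ _ _ (hlt e) (hadj e) h
    arc_inter_arc := fun e e' hee x hx hx' => by
      rw [mem_carrier_segmentArc] at hx hx'
      obtain ⟨w, h1, h2, h3⟩ := hc _ _ _ _ (hlt e) (hlt e') (hadj e) (hadj e') (by
        by_contra hcon
        push Not at hcon
        exact hee (Subtype.ext (by rw [hp e, hp e', hcon.1, hcon.2]))) x hx hx'
      exact ⟨w, by rw [hp e, Sym2.mem_iff]; exact h1, by rw [hp e', Sym2.mem_iff]; exact h2, h3⟩ }⟩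

/-- The path `2, …, n - 1` together with two adjacent vertices `0` and `1` that are joined to all
vertices. -/
def doubleFan (n : ℕ) : SimpleGraph (Fin n) where
  Adj i j := i ≠ j ∧ ((i : ℕ) ≤ 1 ∨ (j : ℕ) ≤ 1 ∨ (i : ℕ) + 1 = j ∨ (j : ℕ) + 1 = i)
  symm := ⟨fun i j h => ⟨h.1.symm, by tauto⟩⟩
  loopless := ⟨fun i h => h.1 rfl⟩

theorem doubleFan_adj {n : ℕ} {i j : Fin n} : (doubleFan n).Adj i j ↔
    (i : ℕ) ≠ j ∧ ((i : ℕ) ≤ 1 ∨ (j : ℕ) ≤ 1 ∨ (i : ℕ) + 1 = j ∨ (j : ℕ) + 1 = i) := by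
  rw [Ne, ← Fin.ext_iff]; rfl

/-- The positions of the vertices in a straight line drawing of the double fan. -/
def doubleFanPos (i : ℕ) : ℝ × ℝ :=
  if i = 0 then (-1, 0) else if i = 1 then (1, 0) else (0, i)

theorem doubleFanPos_cases (i : ℕ) : (i = 0 ∧ doubleFanPos i = (-1, 0)) ∨
    (i = 1 ∧ doubleFanPos i = (1, 0)) ∨ (2 ≤ i ∧ doubleFanPos i = (0, (i : ℝ))) := by
  rcases i with _ | _ | i <;> simp [doubleFanPos]

theorem doubleFanPos_injective : Function.Injective doubleFanPos := by
  intro i j h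
  rcases doubleFanPos_cases i with ⟨hi, hi'⟩ | ⟨hi, hi'⟩ | ⟨hi, hi'⟩ <;>
    rcases doubleFanPos_cases j with ⟨hj, hj'⟩ | ⟨hj, hj'⟩ | ⟨hj, hj'⟩ <;>
    rw [hi', hj', Prod.mk.injEq] at h
  · omega
  · norm_num at h
  · norm_num at h
  · norm_num at h
  · omega
  · norm_num at h
  · norm_num at h
  · norm_num at h
  · exact_mod_cast h.2

/-- Vertices `0` and `1` lie on either side of the vertical axis, which carries the path. The four
kinds of edges get equations that reduce crossings to arithmetic. For the edge `01` the height alone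
suffices, since other edges reach height `0` only at the vertices `0` and `1`. -/
theorem mem_segment_doubleFanPos {u v : ℕ} (huv : u < v) (h : u ≤ 1 ∨ v = u + 1) {x : ℝ × ℝ}
    (hx : x ∈ segment ℝ (doubleFanPos u) (doubleFanPos v)) :
    (u = 0 ∧ v = 1 ∧ x.2 = 0) ∨
    (u = 0 ∧ 2 ≤ v ∧ x.1 ≤ 0 ∧ x.2 = v * (1 + x.1)) ∨
    (u = 1 ∧ 2 ≤ v ∧ 0 ≤ x.1 ∧ x.2 = v * (1 - x.1)) ∨
    (2 ≤ u ∧ v = u + 1 ∧ x.1 = 0 ∧ (u : ℝ) ≤ x.2 ∧ x.2 ≤ u + 1) := by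
  obtain ⟨a, b, ha, hb, hab, rfl⟩ := hx
  have ha' : a = 1 - b := by linarith
  rcases doubleFanPos_cases u with ⟨hu, hu'⟩ | ⟨hu, hu'⟩ | ⟨hu, hu'⟩ <;>
    rcases doubleFanPos_cases v with ⟨hv, hv'⟩ | ⟨hv, hv'⟩ | ⟨hv, hv'⟩ <;> try omega
  · exact .inl ⟨hu, hv, by simp [hu', hv']⟩
  · refine .inr (.inl ⟨hu, hv, ?_, ?_⟩) <;> simp [hu', hv', ha']
    · linarith
    · ring
  · refine .inr (.inr (.inl ⟨hu, hv, ?_, ?_⟩)) <;> simp [hu', hv', ha']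
    · linarith
    · ring
  · have h1 : v = u + 1 := by omega
    subst h1
    refine .inr (.inr (.inr ⟨hu, rfl, ?_, ?_, ?_⟩)) <;> simp [hu', hv', ha'] <;> nlinarith

theorem exists_eq_doubleFanPos {u v u' v' : ℕ} (huv : u < v) (huv' : u' < v')
    (hne : u ≠ u' ∨ v ≠ v') {x : ℝ × ℝ}
    (h : (u = 0 ∧ v = 1 ∧ x.2 = 0) ∨
      (u = 0 ∧ 2 ≤ v ∧ x.1 ≤ 0 ∧ x.2 = v * (1 + x.1)) ∨
      (u = 1 ∧ 2 ≤ v ∧ 0 ≤ x.1 ∧ x.2 = v * (1 - x.1)) ∨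
      (2 ≤ u ∧ v = u + 1 ∧ x.1 = 0 ∧ (u : ℝ) ≤ x.2 ∧ x.2 ≤ u + 1))
    (h' : (u' = 0 ∧ v' = 1 ∧ x.2 = 0) ∨
      (u' = 0 ∧ 2 ≤ v' ∧ x.1 ≤ 0 ∧ x.2 = v' * (1 + x.1)) ∨
      (u' = 1 ∧ 2 ≤ v' ∧ 0 ≤ x.1 ∧ x.2 = v' * (1 - x.1)) ∨
      (2 ≤ u' ∧ v' = u' + 1 ∧ x.1 = 0 ∧ (u' : ℝ) ≤ x.2 ∧ x.2 ≤ u' + 1)) :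
    ∃ w, (w = u ∨ w = v) ∧ (w = u' ∨ w = v') ∧ x = doubleFanPos w := by
  obtain ⟨a, b⟩ := x
  simp only at h h'
  have two : ∀ w : ℕ, 2 ≤ w → doubleFanPos w = (0, (w : ℝ)) := fun w hw => by
    rcases doubleFanPos_cases w with h | h | h
    · omega
    · omega
    · exact h.2
  have zero : doubleFanPos 0 = (-1, 0) := rfl
  have one : doubleFanPos 1 = (1, 0) := rfl
  have pos : ∀ w : ℕ, 2 ≤ w → (w : ℝ) ≠ 0 := fun w hw => by positivity
  have left : ∀ w : ℕ, 2 ≤ w → 0 = w * (1 + a) → a = -1 := fun w hw h => by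
    have := (mul_eq_zero.1 h.symm).resolve_left (pos w hw)
    linarith
  have right : ∀ w : ℕ, 2 ≤ w → 0 = w * (1 - a) → a = 1 := fun w hw h => by
    have := (mul_eq_zero.1 h.symm).resolve_left (pos w hw)
    linarith
  rcases h with ⟨rfl, rfl, h1⟩ | ⟨rfl, h2, h3, h4⟩ | ⟨rfl, h2, h3, h4⟩ | ⟨h1, rfl, h3, h4, h5⟩ <;>
    rcases h' with ⟨rfl, rfl, h1'⟩ | ⟨rfl, h2', h3', h4'⟩ | ⟨rfl, h2', h3', h4'⟩ |
      ⟨h1', rfl, h3', h4', h5'⟩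
  · omega
  · subst h1
    exact ⟨0, .inl rfl, .inl rfl, by rw [zero, left _ h2' h4']⟩
  · subst h1
    exact ⟨1, .inr rfl, .inl rfl, by rw [one, right _ h2' h4']⟩
  · rw [h1] at h4'
    norm_cast at h4'
    omega
  · subst h1'
    exact ⟨0, .inl rfl, .inl rfl, by rw [zero, left _ h2 h4]⟩
  · have hvv : (v : ℝ) - v' ≠ 0 := sub_ne_zero.2 fun h => by norm_cast at h; omega
    have : ((v : ℝ) - v') * (1 + a) = 0 := by linarith
    have ha : a = -1 := by linarith [(mul_eq_zero.1 this).resolve_left hvv]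
    exact ⟨0, .inl rfl, .inl rfl, by rw [zero, h4, ha]; norm_num⟩
  · obtain rfl : a = 0 := le_antisymm h3 h3'
    have : v = v' := by rw [h4] at h4'; norm_num at h4'; exact h4'
    exact ⟨v, .inr rfl, .inr this, by rw [two v h2, h4]; norm_num⟩
  · subst h3'
    rw [h4] at h4' h5'
    norm_num at h4' h5'
    norm_cast at h5'
    exact ⟨v, .inr rfl, by omega, by rw [two v h2, h4]; norm_num⟩
  · subst h1'
    exact ⟨1, .inl rfl, .inr rfl, by rw [one, right _ h2 h4]⟩
  · obtain rfl : a = 0 := le_antisymm h3' h3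
    have : v = v' := by rw [h4] at h4'; norm_num at h4'; exact h4'
    exact ⟨v, .inr rfl, .inr this, by rw [two v h2, h4]; norm_num⟩
  · have hvv : (v : ℝ) - v' ≠ 0 := sub_ne_zero.2 fun h => by norm_cast at h; omega
    have : ((v : ℝ) - v') * (1 - a) = 0 := by linarith
    have ha : a = 1 := by linarith [(mul_eq_zero.1 this).resolve_left hvv]
    exact ⟨1, .inl rfl, .inl rfl, by rw [one, h4, ha]; norm_num⟩
  · subst h3'
    rw [h4] at h4' h5'
    norm_num at h4' h5'
    norm_cast at h5'
    exact ⟨v, .inr rfl, by omega, by rw [two v h2, h4]; norm_num⟩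
  · rw [h1'] at h4
    norm_cast at h4
    omega
  · subst h3
    rw [h4'] at h4 h5
    norm_num at h4 h5
    norm_cast at h5
    exact ⟨v', by omega, .inr rfl, by rw [two v' h2', h4']; norm_num⟩
  · subst h3
    rw [h4'] at h4 h5
    norm_num at h4 h5
    norm_cast at h5
    exact ⟨v', by omega, .inr rfl, by rw [two v' h2', h4']; norm_num⟩
  · subst h3
    have e1 : (u : ℝ) ≤ u' + 1 := h4.trans h5'
    have e2 : (u' : ℝ) ≤ u + 1 := h4'.trans h5
    norm_cast at e1 e2
    have : u' = u + 1 ∨ u = u' + 1 := by omega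
    rcases this with rfl | rfl
    · refine ⟨u + 1, .inr rfl, .inl rfl, ?_⟩
      rw [two _ (by omega), le_antisymm h5 (by exact_mod_cast h4')]
      norm_num
    · refine ⟨u' + 1, .inl rfl, .inr rfl, ?_⟩
      rw [two _ (by omega), le_antisymm h5' (by exact_mod_cast h4)]
      norm_num

theorem isPlanar_doubleFan (n : ℕ) : (doubleFan n).IsPlanar := by
  have hadj : ∀ u v : Fin n, u < v → (doubleFan n).Adj u v → (u : ℕ) ≤ 1 ∨ (v : ℕ) = u + 1 := by
    intro u v huv h
    rw [doubleFan_adj] at h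
    rw [Fin.lt_def] at huv
    omega
  refine isPlanar_of_segments (fun i => doubleFanPos i)
    (doubleFanPos_injective.comp Fin.val_injective) ?_ ?_
  · intro u v w huv h hw
    have := mem_segment_doubleFanPos huv (hadj u v huv h) hw
    simp only [Fin.ext_iff]
    rcases doubleFanPos_cases w with ⟨hw, hw'⟩ | ⟨hw, hw'⟩ | ⟨hw, hw'⟩ <;>
      rw [hw'] at this <;>
      rcases this with ⟨h1, h2, h3⟩ | ⟨h1, h2, h3, h4⟩ | ⟨h1, h2, h3, h4⟩ | ⟨h1, h2, h3, h4, h5⟩ <;>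
      try omega
    · norm_num at h3
    · norm_num at h3
    · norm_num at h3
    · norm_num at h3
    · simp only [Nat.cast_eq_zero] at h3; omega
    · simp only [add_zero, mul_one, Nat.cast_inj] at h4; omega
    · simp only [sub_zero, mul_one, Nat.cast_inj] at h4; omega
    · have e1 : (u : ℕ) ≤ w := Nat.cast_le.1 h4
      have e2 : (w : ℕ) ≤ u + 1 := by
        have h6 : ((w : ℕ) : ℝ) ≤ (u : ℕ) + 1 := h5
        exact_mod_cast h6
      omega
  · intro u v u' v' huv huv' h h' hne x hx hx'
    have h1 := mem_segment_doubleFanPos huv (hadj u v huv h) hx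
    have h2 := mem_segment_doubleFanPos huv' (hadj u' v' huv' h') hx'
    have hne' : (u : ℕ) ≠ u' ∨ (v : ℕ) ≠ v' := by simpa only [ne_eq, Fin.ext_iff] using hne
    suffices H : ∃ w : ℕ, (w = u ∨ w = v) ∧ (w = u' ∨ w = v') ∧ x = doubleFanPos w by
      obtain ⟨w, hw1, hw2, hw3⟩ := H
      refine ⟨⟨w, by omega⟩, ?_, ?_, hw3⟩ <;> simpa only [Fin.ext_iff]
    exact exists_eq_doubleFanPos huv huv' hne' h1 h2

theorem ncard_edges_doubleFan {n m : ℕ} (hm : 3 ≤ m) (hmn : m ≤ n) :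
    {e ∈ (doubleFan n).edgeSet | ∀ v ∈ e, (v : ℕ) < m}.ncard + 6 = 3 * m := by
  induction m, hm using Nat.le_induction with
  | base =>
    have : {e ∈ (doubleFan n).edgeSet | ∀ v ∈ e, (v : ℕ) < 3} =
        {s((⟨0, by omega⟩ : Fin n), ⟨1, by omega⟩), s(⟨0, by omega⟩, ⟨2, by omega⟩),
          s(⟨1, by omega⟩, ⟨2, by omega⟩)} := by
      ext e
      induction e with
      | _ u v =>
      simp only [Set.mem_ofPred_eq, mem_edgeSet, doubleFan_adj, Sym2.ball,
        Set.mem_insert_iff, Set.mem_singleton_iff, Sym2.eq_iff, Fin.ext_iff]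
      omega
    rw [this, Set.ncard_insert_of_notMem _ (Set.toFinite _),
      Set.ncard_insert_of_notMem _ (Set.toFinite _), Set.ncard_singleton] <;>
      simp [Fin.ext_iff]
  | succ m hm ih =>
    -- Vertex `m` brings three new edges, to `0`, `1` and `m - 1`; these are distinct because `m ≥
    -- 3`.
    have : {e ∈ (doubleFan n).edgeSet | ∀ v ∈ e, (v : ℕ) < m + 1} =
        insert s((⟨0, by omega⟩ : Fin n), ⟨m, by omega⟩)
          (insert s(⟨1, by omega⟩, ⟨m, by omega⟩) (insert s(⟨m - 1, by omega⟩, ⟨m, by omega⟩)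
          {e ∈ (doubleFan n).edgeSet | ∀ v ∈ e, (v : ℕ) < m})) := by
      ext e
      induction e with
      | _ u v =>
      simp only [Set.mem_ofPred_eq, mem_edgeSet, doubleFan_adj, Sym2.ball,
        Set.mem_insert_iff, Sym2.eq_iff, Fin.ext_iff]
      omega
    rw [this, Set.ncard_insert_of_notMem _ (Set.toFinite _),
      Set.ncard_insert_of_notMem _ (Set.toFinite _),
      Set.ncard_insert_of_notMem _ (Set.toFinite _)]
    · have := ih (by omega)
      omega
    all_goals
      simp only [Set.mem_ofPred_eq, mem_edgeSet, doubleFan_adj, Sym2.ball,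
        Set.mem_insert_iff, Sym2.eq_iff, Fin.ext_iff]
      omega

theorem ncard_edgeSet_doubleFan {n : ℕ} (hn : 3 ≤ n) :
    (doubleFan n).edgeSet.ncard + 6 = 3 * n := by
  rw [← ncard_edges_doubleFan hn le_rfl]
  congr 2
  ext e
  simp

theorem connected_doubleFan {n : ℕ} (hn : 0 < n) : (doubleFan n).Connected := by
  have h0 : ∀ v, (doubleFan n).Reachable ⟨0, hn⟩ v := by
    intro v
    by_cases hv : v = ⟨0, hn⟩
    · rw [hv]
    · refine Adj.reachable (doubleFan_adj.2 ⟨?_, .inl zero_le_one⟩)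
      rw [Fin.ext_iff] at hv
      exact Ne.symm hv
  have : Nonempty (Fin n) := ⟨⟨0, hn⟩⟩
  exact ⟨fun u v => (h0 u).symm.trans (h0 v)⟩

/-- A connected planar graph with `3 * n - 6` edges is maximal planar. -/
theorem IsPlanar.isMaximalPlanar {V : Type u} [Fintype V] {G : SimpleGraph V} (hG : G.IsPlanar)
    (hconn : G.Connected) (hn : 3 ≤ Fintype.card V)
    (he : 3 * Fintype.card V ≤ G.edgeSet.ncard + 6) : G.IsMaximalPlanar := by
  refine ⟨hG, fun H hH hGH => ?_⟩
  have hHc := hconn.mono hGH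
  obtain ⟨F, -, hF⟩ := hHc.exists_isTree_le
  have hr : F.Reachable = H.Reachable := by
    rw [F.preconnected_iff_reachable_eq_top.1 hF.connected.preconnected,
      H.preconnected_iff_reachable_eq_top.1 hHc.preconnected]
  -- A planar supergraph `H` is connected, so its spanning trees have `n - 1` edges and `H` has at
  -- most `3(n-1) - 3` edges, no more than `G`.
  have h1 := hH.ncard_edgeSet_le hr
  have h2 := hF.ncard_edgeSet
  rw [← edgeSet_subset_edgeSet]
  exact (Set.eq_of_subset_of_ncard_le (edgeSet_mono hGH) (by omega) (Set.toFinite _)).ge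

/-- A forest has fewer than `k` edges within the first `k` vertices. -/
theorem IsAcyclic.ncard_edges_within {n k : ℕ} {T : SimpleGraph (Fin n)} (hT : T.IsAcyclic)
    (hk : 0 < k) (hkn : k ≤ n) : {e ∈ T.edgeSet | ∀ v ∈ e, (v : ℕ) < k}.ncard + 1 ≤ k := by
  have : Nonempty (Fin k) := ⟨⟨0, hk⟩⟩
  obtain ⟨F, hF, -, hFt⟩ := (connected_top (V := Fin k)).exists_isTree_le_of_le_of_isAcyclic
    le_top (hT.of_comap (Fin.castLEEmb hkn))
  have h1 := hFt.ncard_edgeSet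
  rw [Fintype.card_fin] at h1
  have h2 : {e ∈ T.edgeSet | ∀ v ∈ e, (v : ℕ) < k} ⊆ Sym2.map (Fin.castLE hkn) '' F.edgeSet := by
    intro e
    induction e with
    | _ u v =>
    rintro ⟨h, hlt⟩
    exact ⟨s(⟨u, hlt u (Sym2.mem_mk_left _ _)⟩, ⟨v, hlt v (Sym2.mem_mk_right _ _)⟩), hF h, rfl⟩
  have h3 := (Set.ncard_le_ncard h2 (Set.toFinite _)).trans (Set.ncard_image_le (Set.toFinite _))
  omega

-- The first `k` vertices induce `3k - 6` edges, and these get colour `-1`. A tree has at most `k -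
-- 1` edges among them, so its weight is at least `n - 1 - 2(k - 1) ≥ 2`.
open Classical in
theorem exists_maximalPlanar_not_hasBalancedSpanningTree {n : ℕ} (hn : 7 ≤ n) :
    ∃ (G : SimpleGraph (Fin n)) (f : Sym2 (Fin n) → ℤ),
      G.IsMaximalPlanar ∧ G.IsSignColouring f ∧
      min (G.colourCount f (-1)) (G.colourCount f 1) = 3 * ((n - 1) / 2) - 6 ∧
      ¬ G.HasBalancedSpanningTree f := by
  let k := (n - 1) / 2
  have hk : 3 ≤ k := by omega
  have hkn : 2 * k + 1 ≤ n := by omega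
  let f : Sym2 (Fin n) → ℤ := fun e => if ∀ v ∈ e, (v : ℕ) < k then -1 else 1
  have hf : ∀ e, f e = -1 ∨ f e = 1 := fun e => ite_eq_or_eq _ _ _
  have hf' : ∀ e, f e = -1 ↔ ∀ v ∈ e, (v : ℕ) < k := fun e => by simp [f]
  have hall := ncard_edgeSet_doubleFan (n := n) (by omega)
  have h1 : (doubleFan n).colourCount f (-1) + 6 = 3 * k := by
    rw [← ncard_edgeSet_colourClass, edgeSet_colourClass]
    simp only [hf']
    exact ncard_edges_doubleFan hk (by omega)
  have h2 : (doubleFan n).colourCount f (-1) + (doubleFan n).colourCount f 1 =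
      (doubleFan n).edgeSet.ncard := by
    rw [← ncard_edgeSet_colourClass, ← ncard_edgeSet_colourClass, edgeSet_colourClass,
      edgeSet_colourClass, ← Set.ncard_union_eq _ (Set.toFinite _) (Set.toFinite _)]
    · congr 1
      ext e
      have := hf e
      simp only [Set.mem_union, Set.mem_ofPred_eq]
      tauto
    · rw [Set.disjoint_left]
      rintro e ⟨-, h3⟩ ⟨-, h4⟩
      rw [h3] at h4
      norm_num at h4
  refine ⟨doubleFan n, f, (isPlanar_doubleFan n).isMaximalPlanar (connected_doubleFan (by omega))
    (by rw [Fintype.card_fin]; omega) (by rw [Fintype.card_fin]; omega), fun e _ => hf e, ?_, ?_⟩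
  · change _ = 3 * k - 6
    omega
  · rintro ⟨T, -, hT, hw⟩
    rw [weight_eq fun e _ => hf e] at hw
    have h3 := hT.ncard_edgeSet
    rw [Fintype.card_fin] at h3
    have h4 := hT.isAcyclic.ncard_edges_within (k := k) (by omega) (by omega)
    have h5 : T.edgeSet ∩ {e | f e = -1} = {e ∈ T.edgeSet | ∀ v ∈ e, (v : ℕ) < k} := by
      ext e
      simp only [Set.mem_inter_iff, Set.mem_ofPred_eq, hf']
    rw [h5, abs_eq one_pos.le] at hw
    omega

end SimpleGraph

/-! ### From polygonal chains to simple arcs -/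

namespace PolygonalArc

/-- The initial part of an arc that ends in the point `h` of its segment number `i`. -/
def truncate (A : PolygonalArc) (i : ℕ) (hi : i < A.length) (h : ℝ × ℝ)
    (hh : h ∈ segment ℝ (A.pt i) (A.pt (i + 1))) (hne : A.pt i ≠ h) : PolygonalArc where
  length := i + 1
  pt j := if j ≤ i then A.pt j else h
  length_pos := Nat.succ_pos i
  pt_ne j hj := by
    rcases (Nat.lt_succ_iff.1 hj).lt_or_eq with hj | rfl
    · rw [if_pos hj.le, if_pos (Nat.succ_le_iff.2 hj)]
      exact A.pt_ne j (hj.trans hi)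
    · rwa [if_pos le_rfl, if_neg (by omega)]
  simple j j' hjj hj' x hx hx' := by
    have hsub : ∀ k, k ≤ i → segment ℝ (if k ≤ i then A.pt k else h)
        (if k + 1 ≤ i then A.pt (k + 1) else h) ⊆ segment ℝ (A.pt k) (A.pt (k + 1)) := by
      intro k hk
      rw [if_pos hk]
      split_ifs with h1
      · exact subset_rfl
      · obtain rfl : k = i := by omega
        exact (convex_segment _ _).segment_subset (left_mem_segment ℝ _ _) hh
    rw [if_pos (Nat.lt_succ_iff.1 hj')]
    exact A.simple j j' hjj (by omega) x (hsub j (by omega) hx) (hsub j' (by omega) hx')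

theorem mem_carrier_truncate {A : PolygonalArc} {i : ℕ} {hi : i < A.length} {h : ℝ × ℝ}
    {hh : h ∈ segment ℝ (A.pt i) (A.pt (i + 1))} {hne : A.pt i ≠ h} {x : ℝ × ℝ}
    (hx : x ∈ (A.truncate i hi h hh hne).carrier) :
    (∃ j < i, x ∈ segment ℝ (A.pt j) (A.pt (j + 1))) ∨ x ∈ segment ℝ (A.pt i) h := by
  obtain ⟨j, hj, hx⟩ := hx
  simp only [truncate] at hj hx
  rcases (Nat.lt_succ_iff.1 hj).lt_or_eq with hj | rfl
  · rw [if_pos hj.le, if_pos (Nat.succ_le_iff.2 hj)] at hx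
    exact .inl ⟨j, hj, hx⟩
  · rw [if_pos le_rfl, if_neg (by omega)] at hx
    exact .inr hx

/-- An arc prolonged by a segment. -/
def extend (A : PolygonalArc) (q : ℝ × ℝ) (hq : A.pt A.length ≠ q)
    (h : ∀ x ∈ A.carrier, x ∈ segment ℝ (A.pt A.length) q → x = A.pt A.length) :
    PolygonalArc where
  length := A.length + 1
  pt j := if j ≤ A.length then A.pt j else q
  length_pos := Nat.succ_pos _
  pt_ne j hj := by
    rcases (Nat.lt_succ_iff.1 hj).lt_or_eq with hj | rfl
    · rw [if_pos hj.le, if_pos (Nat.succ_le_iff.2 hj)]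
      exact A.pt_ne j hj
    · rwa [if_pos le_rfl, if_neg (by omega)]
  simple j j' hjj hj' x hx hx' := by
    rw [if_pos (by omega), if_pos (by omega)] at hx
    rw [if_pos (by omega)] at hx' ⊢
    rcases (Nat.lt_succ_iff.1 hj').lt_or_eq with hj' | rfl
    · rw [if_pos (by omega)] at hx'
      exact A.simple j j' hjj hj' x hx hx'
    · rw [if_neg (by omega)] at hx'
      obtain rfl := h x ⟨j, hjj, hx⟩ hx'
      exact ⟨(A.succ_eq_length_of_pt_length_mem hjj hx).symm, rfl⟩

theorem mem_carrier_extend {A : PolygonalArc} {q : ℝ × ℝ} {hq : A.pt A.length ≠ q}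
    {h : ∀ x ∈ A.carrier, x ∈ segment ℝ (A.pt A.length) q → x = A.pt A.length} {x : ℝ × ℝ}
    (hx : x ∈ (A.extend q hq h).carrier) :
    x ∈ A.carrier ∨ x ∈ segment ℝ (A.pt A.length) q := by
  obtain ⟨j, hj, hx⟩ := hx
  simp only [extend] at hj hx
  rcases (Nat.lt_succ_iff.1 hj).lt_or_eq with hj | rfl
  · rw [if_pos hj.le, if_pos (Nat.succ_le_iff.2 hj)] at hx
    exact .inl ⟨j, hj, hx⟩
  · rw [if_pos le_rfl, if_neg (by omega)] at hx
    exact .inr hx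

theorem isCompact_segment (p q : ℝ × ℝ) : IsCompact (segment ℝ p q) := by
  rw [← convexHull_pair]
  exact (Set.toFinite _).isCompact_convexHull ℝ

/-- An arc followed by a segment contains an arc with the same ends. -/
theorem exists_arc_of_segment {U : Set (ℝ × ℝ)} (A : PolygonalArc) (hA : A.carrier ⊆ U)
    {q : ℝ × ℝ} (hq : A.pt 0 ≠ q) (hseg : segment ℝ (A.pt A.length) q ⊆ U) :
    ∃ B : PolygonalArc, B.pt 0 = A.pt 0 ∧ B.pt B.length = q ∧ B.carrier ⊆ U := by
  classical
  set s := segment ℝ (A.pt A.length) q with hs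
  -- The arc is cut where it first meets the new segment `s`, and `s` is followed from there. The
  -- first meeting point is found in two stages: the least index `i`, then the point `h` of that
  -- intersection closest to `A.pt i`.
  have hex : ∃ i, i < A.length ∧ (segment ℝ (A.pt i) (A.pt (i + 1)) ∩ s).Nonempty := by
    have h1 := A.length_pos
    refine ⟨A.length - 1, by omega, A.pt A.length, ?_, left_mem_segment ℝ _ _⟩
    have : A.length - 1 + 1 = A.length := by omega
    rw [this]
    exact right_mem_segment ℝ _ _
  obtain ⟨hi, hne⟩ := Nat.find_spec hex
  have hmin : ∀ j < Nat.find hex, ∀ x ∈ segment ℝ (A.pt j) (A.pt (j + 1)), x ∉ s :=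
    fun j hj x hx hxs =>
    Nat.find_min hex hj ⟨hj.trans hi, x, hx, hxs⟩
  generalize Nat.find hex = i at hi hne hmin
  obtain ⟨h, ⟨hhi, hhs⟩, hhmin⟩ :=
    ((isCompact_segment (A.pt i) (A.pt (i + 1))).inter (isCompact_segment _ _)).exists_isMinOn hne
      (continuous_const.dist continuous_id (f := fun _ => A.pt i)).continuousOn
  have hsub : segment ℝ h q ⊆ s :=
    (convex_segment _ _).segment_subset hhs (right_mem_segment ℝ _ _)
  by_cases hpi : A.pt i = h
  · have hi0 : i = 0 := by
      by_contra h0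
      refine hmin (i - 1) (by omega) h ?_ hhs
      have : i - 1 + 1 = i := by omega
      rw [this, hpi]
      exact right_mem_segment ℝ _ _
    subst hi0
    refine ⟨SimpleGraph.segmentArc _ _ hq, rfl, rfl, fun x hx => ?_⟩
    rw [SimpleGraph.mem_carrier_segmentArc, hpi] at hx
    exact hseg (hsub hx)
  · have hfirst : ∀ x ∈ segment ℝ (A.pt i) h, x ∈ s → x = h := by
      intro x hx hxs
      have h1 : dist (A.pt i) h ≤ dist (A.pt i) x := hhmin
        ⟨(convex_segment _ _).segment_subset (left_mem_segment ℝ _ _) hhi hx, hxs⟩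
      have h2 := dist_add_dist_of_mem_segment hx
      exact dist_le_zero.1 (by linarith)
    have hcar : (A.truncate i hi h hhi hpi).carrier ⊆ U := by
      intro x hx
      rcases mem_carrier_truncate hx with ⟨j, hj, hx⟩ | hx
      · exact hA ⟨j, hj.trans hi, hx⟩
      · exact hA ⟨i, hi, (convex_segment _ _).segment_subset (left_mem_segment ℝ _ _) hhi hx⟩
    have hend : (A.truncate i hi h hhi hpi).pt (A.truncate i hi h hhi hpi).length = h :=
      if_neg (by simp [truncate])
    by_cases hhq : h = q
    · exact ⟨A.truncate i hi h hhi hpi, rfl, hend.trans hhq, hcar⟩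
    · refine ⟨(A.truncate i hi h hhi hpi).extend q (by rwa [hend]) ?_, rfl,
        if_neg (by simp [extend]), fun x hx => ?_⟩
      · rw [hend]
        intro x hx hxq
        rcases mem_carrier_truncate hx with ⟨j, hj, hx⟩ | hx
        · exact absurd (hsub hxq) (hmin j hj x hx)
        · exact hfirst x hx (hsub hxq)
      · rcases mem_carrier_extend hx with hx | hx
        · exact hcar hx
        · rw [hend] at hx
          exact hseg (hsub hx)

end PolygonalArc

/-- `p` and `q` are joined by a polygonal chain in `U`. -/
def PolygonallyJoined (U : Set (ℝ × ℝ)) : ℝ × ℝ → ℝ × ℝ → Prop :=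
  Relation.ReflTransGen fun p q => segment ℝ p q ⊆ U

namespace PolygonallyJoined

variable {U U' : Set (ℝ × ℝ)} {p q : ℝ × ℝ}

theorem single (h : segment ℝ p q ⊆ U) : PolygonallyJoined U p q := Relation.ReflTransGen.single h

theorem trans {r : ℝ × ℝ} (h : PolygonallyJoined U p q) (h' : PolygonallyJoined U q r) :
    PolygonallyJoined U p r := Relation.ReflTransGen.trans h h'

theorem symm (h : PolygonallyJoined U p q) : PolygonallyJoined U q p := by
  induction h with
  | refl => exact Relation.ReflTransGen.refl
  | tail _ h ih => exact (single (by rwa [segment_symm])).trans ih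

theorem mono (hU : U ⊆ U') (h : PolygonallyJoined U p q) : PolygonallyJoined U' p q := by
  induction h with
  | refl => exact Relation.ReflTransGen.refl
  | tail _ h ih => exact ih.trans (single (h.trans hU))

theorem mem (hp : p ∈ U) (h : PolygonallyJoined U p q) : q ∈ U := by
  induction h with
  | refl => exact hp
  | tail _ h _ => exact h (right_mem_segment ℝ _ _)

theorem exists_arc (h : PolygonallyJoined U p q) (hpq : p ≠ q) :
    ∃ A : PolygonalArc, A.pt 0 = p ∧ A.pt A.length = q ∧ A.carrier ⊆ U := by
  induction h with
  | refl => exact absurd rfl hpq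
  | @tail q r _ hqr ih =>
    -- If the chain has returned to its start, everything before is dropped and the last segment is
    -- the arc.
    by_cases hq : p = q
    · subst hq
      refine ⟨SimpleGraph.segmentArc _ _ hpq, rfl, rfl, fun x hx => ?_⟩
      rw [SimpleGraph.mem_carrier_segmentArc] at hx
      exact hqr hx
    · obtain ⟨A, rfl, rfl, hA⟩ := ih hq
      exact A.exists_arc_of_segment hA hpq hqr

end PolygonallyJoined

/-! ### Components of the complement near a point of the drawing -/

section

open Filter Topology

/-- The ray from `x` in direction `d`. -/
def rayFrom (x d : ℝ × ℝ) : Set (ℝ × ℝ) := {y | ∃ t : ℝ, 0 ≤ t ∧ y = x + t • d}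

theorem rayFrom_zero (x : ℝ × ℝ) : rayFrom x 0 = {x} := by
  ext y
  constructor
  · rintro ⟨t, -, rfl⟩
    simp
  · rintro rfl
    exact ⟨0, le_rfl, by simp⟩

theorem self_mem_rayFrom (x d : ℝ × ℝ) : x ∈ rayFrom x d := ⟨0, le_rfl, by simp⟩

theorem eventually_mem_of_mem_rayFrom (x a : ℝ × ℝ) :
    ∀ᶠ y in 𝓝 x, y ∈ rayFrom x (a - x) → y ∈ segment ℝ x a := by
  by_cases h : a = x
  · subst h
    refine Eventually.of_forall fun y hy => ?_
    rw [sub_self, rayFrom_zero] at hy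
    rw [hy]
    exact left_mem_segment ℝ _ _
  · have h0 : 0 < ‖a - x‖ := norm_pos_iff.2 (sub_ne_zero.2 h)
    filter_upwards [Metric.ball_mem_nhds x h0] with y hy
    rintro ⟨t, ht, rfl⟩
    rw [Metric.mem_ball, dist_eq_norm, add_sub_cancel_left, norm_smul, Real.norm_of_nonneg ht] at hy
    have ht1 : t < 1 := by
      by_contra hcon
      have := mul_le_mul_of_nonneg_right (not_lt.1 hcon) h0.le
      linarith
    rw [segment_eq_image']
    exact ⟨t, ⟨ht, ht1.le⟩, rfl⟩

/-- Near one of its points, a segment is the union of two rays. -/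
theorem eventually_mem_segment_iff {a b x : ℝ × ℝ} (hx : x ∈ segment ℝ a b) :
    ∀ᶠ y in 𝓝 x, y ∈ segment ℝ a b ↔ y ∈ rayFrom x (a - x) ∨ y ∈ rayFrom x (b - x) := by
  filter_upwards [eventually_mem_of_mem_rayFrom x a, eventually_mem_of_mem_rayFrom x b] with y h1 h2
  have hconv := convex_segment (𝕜 := ℝ) a b
  constructor
  · intro hy
    rw [segment_eq_image'] at hx hy
    obtain ⟨s, ⟨hs0, hs1⟩, rfl⟩ := hx
    obtain ⟨t, ⟨ht0, ht1⟩, rfl⟩ := hy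
    have ea : ∀ c : ℝ, a + s • (b - a) + c • (a - (a + s • (b - a))) = a + (s - c * s) • (b - a) :=
      fun c => by module
    have eb : ∀ c : ℝ, a + s • (b - a) + c • (b - (a + s • (b - a))) =
        a + (s + c * (1 - s)) • (b - a) := fun c => by module
    rcases le_or_gt t s with hts | hts
    · rcases hs0.eq_or_lt with rfl | hs0
      · obtain rfl : t = 0 := le_antisymm hts ht0
        exact .inl (self_mem_rayFrom _ _)
      · refine .inl ⟨(s - t) / s, div_nonneg (by linarith) hs0.le, ?_⟩
        simp only [ea]
        rw [div_mul_cancel₀ _ hs0.ne', sub_sub_cancel]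
    · have hs : 0 < 1 - s := by linarith
      refine .inr ⟨(t - s) / (1 - s), div_nonneg (by linarith) hs.le, ?_⟩
      simp only [eb]
      rw [div_mul_cancel₀ _ hs.ne', add_sub_cancel]
  · rintro (hy | hy)
    · exact hconv.segment_subset hx (left_mem_segment ℝ _ _) (h1 hy)
    · exact hconv.segment_subset hx (right_mem_segment ℝ _ _) (h2 hy)

theorem isClosed_segment (a b : ℝ × ℝ) : IsClosed (segment ℝ a b) :=
  (PolygonalArc.isCompact_segment a b).isClosed

theorem openSegment_eq_add_smul (x y : ℝ × ℝ) {z : ℝ × ℝ} (hz : z ∈ openSegment ℝ x y) :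
    ∃ t : ℝ, 0 < t ∧ t < 1 ∧ z = x + t • (y - x) := by
  rw [openSegment_eq_image'] at hz
  obtain ⟨t, ⟨h0, h1⟩, rfl⟩ := hz
  exact ⟨t, h0, h1, rfl⟩

theorem mem_rayFrom_of_openSegment {x y z d : ℝ × ℝ} (hz : z ∈ openSegment ℝ x y)
    (hd : z ∈ rayFrom x d) : y ∈ rayFrom x d := by
  obtain ⟨t, h0, -, rfl⟩ := openSegment_eq_add_smul x y hz
  obtain ⟨s, hs, h⟩ := hd
  refine ⟨s / t, div_nonneg hs h0.le, ?_⟩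
  have h' : t • (y - x) = s • d := add_left_cancel h
  rw [div_eq_inv_mul, mul_smul, ← h', smul_smul, inv_mul_cancel₀ h0.ne', one_smul]
  abel

/-- A segment is locally star-shaped around each point, and so is its complement. -/
theorem eventually_mem_segment_of_openSegment (a b x : ℝ × ℝ) :
    ∀ᶠ y in 𝓝 x, ∀ z ∈ openSegment ℝ x y, z ∈ segment ℝ a b → y ∈ segment ℝ a b := by
  by_cases hx : x ∈ segment ℝ a b
  · obtain ⟨r, hr, hball⟩ := Metric.eventually_nhds_iff_ball.1 (eventually_mem_segment_iff hx)
    filter_upwards [Metric.ball_mem_nhds x hr] with y hy z hz hzs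
    have hz' : z ∈ Metric.ball x r := (convex_ball x r).openSegment_subset
      (Metric.mem_ball_self hr) hy hz
    rw [hball y hy]
    exact ((hball z hz').1 hzs).imp (mem_rayFrom_of_openSegment hz) (mem_rayFrom_of_openSegment hz)
  · have := (isClosed_segment a b).isOpen_compl.mem_nhds hx
    obtain ⟨r, hr, hball⟩ := Metric.mem_nhds_iff.1 this
    filter_upwards [Metric.ball_mem_nhds x hr] with y hy z hz hzs
    exact absurd hzs (hball ((convex_ball x r).openSegment_subset (Metric.mem_ball_self hr) hy hz))

/-- The points joined to `p` in `U` by polygonal chains. -/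
def polygonalComponent (U : Set (ℝ × ℝ)) (p : ℝ × ℝ) : Set (ℝ × ℝ) := {q | PolygonallyJoined U p q}

theorem mem_polygonalComponent_of_segment {U : Set (ℝ × ℝ)} {p q r : ℝ × ℝ}
    (hq : q ∈ polygonalComponent U p) (h : segment ℝ q r ⊆ U) : r ∈ polygonalComponent U p :=
  PolygonallyJoined.trans hq (.single h)

/-- The points strictly between `w` and `y` are joined to `w` by straight segments in `U`, and they
accumulate at `y`. -/
theorem mem_closure_polygonalComponent {U : Set (ℝ × ℝ)} {p w y : ℝ × ℝ} (hp : p ∈ U)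
    (hw : w ∈ polygonalComponent U p) (h : openSegment ℝ w y ⊆ U) :
    y ∈ closure (polygonalComponent U p) := by
  have hsub : openSegment ℝ w y ⊆ polygonalComponent U p := by
    intro z hz
    refine mem_polygonalComponent_of_segment hw ?_
    intro u hu
    rw [← insert_endpoints_openSegment] at hu
    rcases hu with rfl | rfl | hu
    · exact PolygonallyJoined.mem hp hw
    · exact h hz
    · refine h ?_
      rw [openSegment_eq_image'] at hz hu ⊢
      obtain ⟨t, ⟨ht0, ht1⟩, rfl⟩ := hz
      obtain ⟨s, ⟨hs0, hs1⟩, rfl⟩ := hu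
      refine ⟨s * t, ⟨mul_pos hs0 ht0, by nlinarith⟩, ?_⟩
      module
  exact closure_mono hsub (segment_subset_closure_openSegment (right_mem_segment ℝ _ _))

/-- If `X` is near `x` the union of two rays in different directions, and `x` is adherent to a
component of the complement of `X`, then so are the points of `X` near `x`. -/
theorem eventually_mem_closure_polygonalComponent {X : Set (ℝ × ℝ)} {p x d₁ d₂ : ℝ × ℝ}
    (hp : p ∉ X) (hd₁ : d₁ ≠ 0) (hd₂ : d₂ ≠ 0) (hd : ∀ c : ℝ, 0 < c → d₂ ≠ c • d₁)
    (hX : ∀ᶠ y in 𝓝 x, y ∈ X ↔ y ∈ rayFrom x d₁ ∨ y ∈ rayFrom x d₂)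
    (hx : x ∈ closure (polygonalComponent Xᶜ p)) :
    ∀ᶠ y in 𝓝 x, y ∈ X → y ∈ closure (polygonalComponent Xᶜ p) := by
  obtain ⟨r, hr, hball⟩ := Metric.eventually_nhds_iff_ball.1 hX
  obtain ⟨w, hw, hwx⟩ := Metric.mem_closure_iff.1 hx r hr
  rw [dist_comm] at hwx
  have hwX : w ∉ X := PolygonallyJoined.mem (U := Xᶜ) hp hw
  obtain ⟨u, rfl⟩ : ∃ u, w = x + u := ⟨w - x, by abel⟩
  have hu : ∀ d, (d = d₁ ∨ d = d₂) → ∀ t : ℝ, 0 ≤ t → u ≠ t • d := by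
    rintro d hd t ht rfl
    refine hwX ((hball _ hwx).2 ?_)
    rcases hd with rfl | rfl
    · exact .inl ⟨t, ht, rfl⟩
    · exact .inr ⟨t, ht, rfl⟩
  have hxball := Metric.mem_ball_self (x := x) hr
  have main : ∀ e₁ e₂ : ℝ × ℝ, e₁ ≠ 0 → e₂ ≠ 0 → (∀ c : ℝ, 0 < c → e₂ ≠ c • e₁) →
      (∀ y ∈ Metric.ball x r, y ∈ X ↔ y ∈ rayFrom x e₁ ∨ y ∈ rayFrom x e₂) →
      (∀ t : ℝ, 0 ≤ t → u ≠ t • e₁) → (∀ t : ℝ, 0 ≤ t → u ≠ t • e₂) →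
      ∀ y ∈ Metric.ball x r, y ∈ rayFrom x e₁ → y ∈ closure (polygonalComponent Xᶜ p) := by
    rintro e₁ e₂ he₁ he₂ he hbl hu₁ hu₂ y hy ⟨t, ht, rfl⟩
    rcases ht.eq_or_lt with rfl | ht
    · simpa using hx
    have hin : ∀ v ∈ Metric.ball x r, ∀ z ∈ openSegment ℝ v (x + t • e₁), z ∈ Metric.ball x r :=
      fun v hv z hz => (convex_ball x r).openSegment_subset hv hy hz
    -- If the second ray does not block the view from `w = x + u`, then neither does the first:
    -- meeting the first ray would make `u` a negative multiple of `e₁`, and the view would pass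
    -- through `x`, which lies on the second ray.
    by_cases hA : ∀ z ∈ openSegment ℝ (x + u) (x + t • e₁), z ∉ rayFrom x e₂
    · refine mem_closure_polygonalComponent hp hw fun z hz hzX => ?_
      rcases (hbl z (hin _ hwx z hz)).1 hzX with ⟨τ, hτ, h⟩ | h
      · obtain ⟨s, hs0, hs1, hs⟩ := openSegment_eq_add_smul _ _ hz
        have hs' : 0 < 1 - s := by linarith
        have hue : u = ((τ - s * t) / (1 - s)) • e₁ := by
          have : (1 - s) • u = (τ - s * t) • e₁ := by
            have h2 : x + u + s • (x + t • e₁ - (x + u)) = x + τ • e₁ := hs.symm.trans h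
            have h3 : (1 - s) • u + (s * t) • e₁ = τ • e₁ := by
              have h4 : x + ((1 - s) • u + (s * t) • e₁) = x + τ • e₁ := by
                rw [← h2]; module
              exact add_left_cancel h4
            rw [sub_smul τ, ← h3]; abel
          rw [div_eq_inv_mul, mul_smul, ← this, smul_smul, inv_mul_cancel₀ hs'.ne', one_smul]
        have hneg : (τ - s * t) / (1 - s) < 0 := by
          by_contra hcon
          exact hu₁ _ (not_lt.1 hcon) hue
        generalize (τ - s * t) / (1 - s) = c at hue hneg
        have htc : 0 < t - c := by linarith
        refine hA x ?_ (self_mem_rayFrom _ _)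
        rw [openSegment_eq_image']
        refine ⟨-c / (t - c), ⟨div_pos (by linarith) htc, (div_lt_one htc).2 (by linarith)⟩, ?_⟩
        have h5 : x + u + (-c / (t - c)) • (x + t • e₁ - (x + u)) =
            x + (c + (-c / (t - c)) * (t - c)) • e₁ := by
          rw [hue]; module
        simp only
        rw [h5, div_mul_cancel₀ _ htc.ne']
        simp
      · exact hA z hz h
    · push Not at hA
      obtain ⟨z, hz, τ, hτ, h⟩ := hA
      obtain ⟨s, hs0, hs1, hs⟩ := openSegment_eq_add_smul _ _ hz
      have hs' : 0 < 1 - s := by linarith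
      obtain ⟨α, β, hα, hβ, hue⟩ : ∃ α β : ℝ, 0 ≤ α ∧ 0 < β ∧ u = α • e₂ - β • e₁ := by
        refine ⟨τ / (1 - s), s * t / (1 - s), div_nonneg hτ hs'.le,
          div_pos (mul_pos hs0 ht) hs', ?_⟩
        have h2 : x + u + s • (x + t • e₁ - (x + u)) = x + τ • e₂ := hs.symm.trans h
        have h3 : (1 - s) • u = τ • e₂ - (s * t) • e₁ := by
          have h4 : x + (1 - s) • u = x + (τ • e₂ - (s * t) • e₁) := by
            have h5 : x + (1 - s) • u = x + u + s • (x + t • e₁ - (x + u)) - (s * t) • e₁ := by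
              module
            rw [h5, h2]; abel
          exact add_left_cancel h4
        rw [div_eq_inv_mul, div_eq_inv_mul, mul_smul, mul_smul, ← smul_sub, ← h3, smul_smul,
          inv_mul_cancel₀ hs'.ne', one_smul]
      -- If `e₂` were a negative multiple of `e₁`, then `u = α • e₂ - β • e₁` would lie on the
      -- second ray.
      have hindep : ∀ a b : ℝ, a • e₂ = b • e₁ → a = 0 ∧ b = 0 := by
        intro a b hab
        by_cases ha : a = 0
        · subst ha
          rw [zero_smul] at hab
          exact ⟨rfl, (smul_eq_zero.1 hab.symm).resolve_right he₁⟩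
        · exfalso
          have he₂' : e₂ = (b / a) • e₁ := by
            rw [div_eq_inv_mul, mul_smul, ← hab, smul_smul, inv_mul_cancel₀ ha, one_smul]
          rcases lt_trichotomy (b / a) 0 with hc | hc | hc
          · refine hu₂ (α - β / (b / a)) ?_ ?_
            · have := div_neg_of_pos_of_neg hβ hc
              linarith
            · have h6 : e₁ = (b / a)⁻¹ • e₂ := by
                rw [he₂', smul_smul, inv_mul_cancel₀ hc.ne, one_smul]
              rw [hue, sub_smul, div_eq_mul_inv β, mul_smul, ← h6]
          · rw [hc, zero_smul] at he₂'
            exact he₂ he₂'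
          · exact he _ hc he₂'
      -- The blocked view is replaced by a detour behind `x`: the point `x - ε • e₂` is seen from
      -- `w` and sees the target on the first ray.
      obtain ⟨ε, hε, hεr⟩ : ∃ ε : ℝ, 0 < ε ∧ x + (-ε) • e₂ ∈ Metric.ball x r := by
        have hn : 0 < ‖e₂‖ := norm_pos_iff.2 he₂
        refine ⟨r / (2 * ‖e₂‖), by positivity, ?_⟩
        rw [Metric.mem_ball, dist_eq_norm, add_sub_cancel_left, norm_smul, norm_neg,
          Real.norm_of_nonneg (by positivity)]
        have : r / (2 * ‖e₂‖) * ‖e₂‖ = r / 2 := by field_simp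
        rw [this]
        linarith
      have hm : x + (-ε) • e₂ ∈ polygonalComponent Xᶜ p := by
        refine mem_polygonalComponent_of_segment hw fun z hz hzX => ?_
        have hzb := (convex_ball x r).segment_subset hwx hεr hz
        rw [segment_eq_image'] at hz
        obtain ⟨q, ⟨hq0, hq1⟩, rfl⟩ := hz
        have e : x + u + q • (x + (-ε) • e₂ - (x + u)) =
            x + (((1 - q) * α - q * ε) • e₂ - ((1 - q) * β) • e₁) := by
          rw [hue]; module
        simp only [e] at hzb hzX
        rcases (hbl _ hzb).1 hzX with ⟨k, hk, h⟩ | ⟨k, hk, h⟩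
        · have h := add_left_cancel h
          obtain ⟨i1, i2⟩ := hindep ((1 - q) * α - q * ε) (k + (1 - q) * β) (by
            rw [add_smul, ← h]; abel)
          have i3 : 0 ≤ (1 - q) * β := mul_nonneg (by linarith) hβ.le
          have i4 : (1 - q) * β = 0 := by linarith
          have i5 : 1 - q = 0 := (mul_eq_zero.1 i4).resolve_right hβ.ne'
          rw [i5, zero_mul, zero_sub, neg_eq_zero] at i1
          have : q = 1 := by linarith
          rw [this, one_mul] at i1
          exact hε.ne' i1
        · have h := add_left_cancel h
          obtain ⟨i1, i2⟩ := hindep ((1 - q) * α - q * ε - k) ((1 - q) * β) (by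
            rw [sub_smul, ← h]; abel)
          have i5 : 1 - q = 0 := (mul_eq_zero.1 i2).resolve_right hβ.ne'
          rw [i5, zero_mul, zero_sub] at i1
          have : q = 1 := by linarith
          rw [this, one_mul] at i1
          linarith
      refine mem_closure_polygonalComponent hp hm fun z hz hzX => ?_
      have hzb := hin _ hεr z hz
      obtain ⟨q, hq0, hq1, rfl⟩ := openSegment_eq_add_smul _ _ hz
      have e : x + (-ε) • e₂ + q • (x + t • e₁ - (x + (-ε) • e₂)) =
          x + ((q * t) • e₁ - ((1 - q) * ε) • e₂) := by module
      rw [e] at hzb hzX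
      have hqe : 0 < (1 - q) * ε := mul_pos (by linarith) hε
      rcases (hbl _ hzb).1 hzX with ⟨k, hk, h⟩ | ⟨k, hk, h⟩
      · have h := add_left_cancel h
        obtain ⟨i1, i2⟩ := hindep ((1 - q) * ε) (q * t - k) (by
          rw [sub_smul, ← h]; abel)
        exact hqe.ne' i1
      · have h := add_left_cancel h
        obtain ⟨i1, i2⟩ := hindep (k + (1 - q) * ε) (q * t) (by
          rw [add_smul, ← h]; abel)
        linarith
  filter_upwards [Metric.ball_mem_nhds x hr] with y hy hyX
  rcases (hball y hy).1 hyX with h | h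
  · exact main d₁ d₂ hd₁ hd₂ hd hball (hu _ (.inl rfl)) (hu _ (.inr rfl)) y hy h
  · refine main d₂ d₁ hd₂ hd₁ (fun c hc h => hd c⁻¹ (inv_pos.2 hc) ?_)
      (fun y hy => (hball y hy).trans or_comm) (hu _ (.inr rfl)) (hu _ (.inl rfl)) y hy h
    rw [h, smul_smul, inv_mul_cancel₀ hc.ne', one_smul]

theorem PolygonalArc.isPreconnected_carrier (A : PolygonalArc) : IsPreconnected A.carrier := by
  have h : A.carrier = ⋃ i ∈ Set.Iio A.length, segment ℝ (A.pt i) (A.pt (i + 1)) := by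
    ext x
    simp [carrier]
  rw [h]
  refine IsPreconnected.biUnion_of_chain Set.ordConnected_Iio
    (fun i _ => (convex_segment _ _).isPreconnected) fun i _ _ => ?_
  exact ⟨A.pt (i + 1), right_mem_segment ℝ _ _, left_mem_segment ℝ _ _⟩

theorem PolygonalArc.isCompact_carrier (A : PolygonalArc) : IsCompact A.carrier := by
  have h : A.carrier = ⋃ i ∈ Set.Iio A.length, segment ℝ (A.pt i) (A.pt (i + 1)) := by
    ext x
    simp [carrier]
  rw [h]
  exact (Set.finite_Iio _).isCompact_biUnion fun i _ => isCompact_segment _ _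

theorem PolygonalArc.pt_zero_mem_carrier (A : PolygonalArc) : A.pt 0 ∈ A.carrier :=
  ⟨0, A.length_pos, left_mem_segment ℝ _ _⟩

/-- Near an inner point an arc is the union of two rays in different directions. -/
theorem PolygonalArc.exists_rays (A : PolygonalArc) {x : ℝ × ℝ} (hx : x ∈ A.carrier)
    (h0 : x ≠ A.pt 0) (h1 : x ≠ A.pt A.length) :
    ∃ d₁ d₂ : ℝ × ℝ, d₁ ≠ 0 ∧ d₂ ≠ 0 ∧ (∀ c : ℝ, 0 < c → d₂ ≠ c • d₁) ∧
      ∀ᶠ y in 𝓝 x, y ∈ A.carrier ↔ y ∈ rayFrom x d₁ ∨ y ∈ rayFrom x d₂ := by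
  have hfar : ∀ᶠ y in 𝓝 x, ∀ i ∈ Set.Iio A.length, x ∉ segment ℝ (A.pt i) (A.pt (i + 1)) →
      y ∉ segment ℝ (A.pt i) (A.pt (i + 1)) := by
    rw [(Set.finite_Iio A.length).eventually_all]
    intro i _
    by_cases h : x ∈ segment ℝ (A.pt i) (A.pt (i + 1))
    · exact Eventually.of_forall fun y h' => absurd h h'
    · filter_upwards [(isClosed_segment _ _).isOpen_compl.mem_nhds h] with y hy _ using hy
  by_cases hbend : ∃ i, i + 1 < A.length ∧ x = A.pt (i + 1)
  · obtain ⟨i, hi, rfl⟩ := hbend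
    have hl := A.pt_ne i (by omega)
    have hr := A.pt_ne (i + 1) hi
    refine ⟨A.pt i - A.pt (i + 1), A.pt (i + 1 + 1) - A.pt (i + 1), sub_ne_zero.2 hl,
      sub_ne_zero.2 hr.symm, ?_, ?_⟩
    · intro c hc hcc
      -- If the two directions agreed, consecutive segments would share this point as well; the
      -- factor `min 1 c` keeps it within both.
      have key : A.pt (i + 1) + (min 1 c) • (A.pt i - A.pt (i + 1)) = A.pt (i + 1) := by
        refine (A.simple i (i + 1) (by omega) hi _ ?_ ?_).2
        · rw [segment_symm, segment_eq_image']
          exact ⟨min 1 c, ⟨le_min zero_le_one hc.le, min_le_left _ _⟩, rfl⟩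
        · rw [segment_eq_image']
          refine ⟨min 1 c / c, ⟨div_nonneg (le_min zero_le_one hc.le) hc.le,
            (div_le_one hc).2 (min_le_right _ _)⟩, ?_⟩
          simp only
          rw [hcc, smul_smul, div_mul_cancel₀ _ hc.ne']
      have h2 := (smul_eq_zero.1 (add_eq_left.1 key)).resolve_right (sub_ne_zero.2 hl)
      exact (lt_min one_pos hc).ne' h2
    · filter_upwards [hfar,
        eventually_mem_segment_iff (right_mem_segment ℝ (A.pt i) (A.pt (i + 1))),
        eventually_mem_segment_iff (left_mem_segment ℝ (A.pt (i + 1)) (A.pt (i + 1 + 1)))]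
        with y hy hy1 hy2
      have hself : ∀ d, y ∈ rayFrom (A.pt (i + 1)) 0 → y ∈ rayFrom (A.pt (i + 1)) d := by
        intro d h
        rw [rayFrom_zero] at h
        rw [h]
        exact self_mem_rayFrom _ _
      rw [sub_self] at hy1 hy2
      constructor
      · rintro ⟨j, hj, hyj⟩
        have hxj : A.pt (i + 1) ∈ segment ℝ (A.pt j) (A.pt (j + 1)) := by
          by_contra h
          exact hy j hj h hyj
        have : j = i ∨ j = i + 1 := by
          by_contra hcon
          push Not at hcon
          rcases lt_or_gt_of_ne hcon.1 with h | h
          · have := (A.simple j (i + 1) (by omega) hi _ hxj (left_mem_segment ℝ _ _)).1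
            omega
          · have := (A.simple i j h hj _ (right_mem_segment ℝ _ _) hxj).1
            omega
        rcases this with rfl | rfl
        · rcases hy1.1 hyj with h | h
          · exact .inl h
          · exact .inl (hself _ h)
        · rcases hy2.1 hyj with h | h
          · exact .inr (hself _ h)
          · exact .inr h
      · rintro (h | h)
        · exact ⟨i, by omega, hy1.2 (.inl h)⟩
        · exact ⟨i + 1, hi, hy2.2 (.inr h)⟩
  · push Not at hbend
    obtain ⟨i, hi, hxi⟩ := hx
    have hxl : A.pt i ≠ x := by
      rintro rfl
      rcases i with _ | i
      · exact h0 rfl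
      · exact hbend i hi rfl
    have hxr : A.pt (i + 1) ≠ x := by
      rintro rfl
      rcases (Nat.succ_le_iff.2 hi).lt_or_eq with h | h
      · exact hbend i h rfl
      · exact h1 (congrArg A.pt h)
    refine ⟨A.pt i - x, A.pt (i + 1) - x, sub_ne_zero.2 hxl, sub_ne_zero.2 hxr, ?_, ?_⟩
    · intro c hc hcc
      rw [segment_eq_image'] at hxi
      obtain ⟨t, ⟨ht0, ht1⟩, rfl⟩ := hxi
      have h2 : (1 - t + c * t) • (A.pt (i + 1) - A.pt i) = 0 := by
        have e1 : A.pt (i + 1) - (A.pt i + t • (A.pt (i + 1) - A.pt i)) -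
          c • (A.pt i - (A.pt i + t • (A.pt (i + 1) - A.pt i))) =
          (1 - t + c * t) • (A.pt (i + 1) - A.pt i) := by module
        rw [← e1, hcc, sub_self]
      have h3 := (smul_eq_zero.1 h2).resolve_right (sub_ne_zero.2 (A.pt_ne i hi).symm)
      have h4 : 0 ≤ c * t := mul_nonneg hc.le ht0
      have h5 : t = 1 := by linarith
      rw [h5] at h3
      linarith
    · filter_upwards [hfar, eventually_mem_segment_iff hxi] with y hy hy1
      rw [← hy1]
      constructor
      · rintro ⟨j, hj, hyj⟩
        have hxj : x ∈ segment ℝ (A.pt j) (A.pt (j + 1)) := by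
          by_contra h
          exact hy j hj h hyj
        have : j = i := by
          by_contra hcon
          rcases lt_or_gt_of_ne hcon with h | h
          · obtain ⟨rfl, h⟩ := A.simple j i h hi _ hxj hxi
            exact hxl h.symm
          · obtain ⟨rfl, h⟩ := A.simple i j h hj _ hxi hxj
            exact hxr h.symm
        rwa [← this]
      · exact fun h => ⟨i, hi, h⟩

/-- Two disjoint compact sets contain points that are visible from a common point. -/
theorem exists_openSegment_subset_compl {K L : Set (ℝ × ℝ)} (hK : IsCompact K) (hL : IsCompact L)
    (hK0 : K.Nonempty) (hL0 : L.Nonempty) (hKL : Disjoint K L) :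
    ∃ p, ∃ x ∈ K, ∃ y ∈ L, p ∉ K ∪ L ∧ openSegment ℝ p x ⊆ (K ∪ L)ᶜ ∧
      openSegment ℝ p y ⊆ (K ∪ L)ᶜ := by
  -- An inner point of a shortest segment between the sets lies in neither, as it would give a
  -- closer pair. The common viewpoint is the midpoint.
  obtain ⟨⟨x, y⟩, ⟨hx, hy⟩, hmin⟩ := (hK.prod hL).exists_isMinOn (hK0.prod hL0)
    continuous_dist.continuousOn
  have hd : 0 < dist x y := dist_pos.2 fun h => Set.disjoint_left.1 hKL hx (h ▸ hy)
  have hfree : ∀ t : ℝ, 0 < t → t < 1 → x + t • (y - x) ∉ K ∪ L := by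
    rintro t ht0 ht1 (h | h)
    · have h1 : dist x y ≤ dist (x + t • (y - x)) y := hmin (a := (_, y)) ⟨h, hy⟩
      have h2 : dist (x + t • (y - x)) y = (1 - t) * dist x y := by
        rw [dist_eq_norm, dist_eq_norm,
          show x + t • (y - x) - y = (1 - t) • (x - y) by module, norm_smul,
          Real.norm_of_nonneg (by linarith)]
      nlinarith
    · have h1 : dist x y ≤ dist x (x + t • (y - x)) := hmin (a := (x, _)) ⟨hx, h⟩
      have h2 : dist x (x + t • (y - x)) = t * dist x y := by
        rw [dist_eq_norm, dist_eq_norm,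
          show x - (x + t • (y - x)) = t • (x - y) by module, norm_smul,
          Real.norm_of_nonneg ht0.le]
      nlinarith
  refine ⟨x + (1 / 2 : ℝ) • (y - x), x, hx, y, hy, hfree _ (by norm_num) (by norm_num), ?_, ?_⟩
  · intro z hz
    obtain ⟨t, ht0, ht1, rfl⟩ := openSegment_eq_add_smul _ _ hz
    rw [show x + (1 / 2 : ℝ) • (y - x) + t • (x - (x + (1 / 2 : ℝ) • (y - x))) =
      x + ((1 - t) / 2) • (y - x) by module]
    exact hfree _ (by linarith) (by linarith)
  · intro z hz
    obtain ⟨t, ht0, ht1, rfl⟩ := openSegment_eq_add_smul _ _ hz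
    rw [show x + (1 / 2 : ℝ) • (y - x) + t • (y - (x + (1 / 2 : ℝ) • (y - x))) =
      x + ((1 + t) / 2) • (y - x) by module]
    exact hfree _ (by linarith) (by linarith)

/-! ### Adding an edge to a disconnected plane graph -/

namespace SimpleGraph

variable {V : Type u} {G : SimpleGraph V}

namespace PlaneDrawing

variable (D : PlaneDrawing G)

/-- The part of a drawing formed by the vertices in `s` and the edges with both ends in `s`. -/
def part (s : Set V) : Set (ℝ × ℝ) :=
  D.pos '' s ∪ ⋃ e ∈ {e : G.edgeSet | ∀ v ∈ (e : Sym2 V), v ∈ s}, (D.arc e).carrier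

/-- The set of points of a drawing. -/
def carrier : Set (ℝ × ℝ) := D.part Set.univ

theorem arc_subset_carrier (e : G.edgeSet) : (D.arc e).carrier ⊆ D.carrier :=
  fun _ hx => .inr (Set.mem_biUnion (x := e) (fun _ _ => Set.mem_univ _) hx)

theorem pos_mem_carrier (v : V) : D.pos v ∈ D.carrier := .inl ⟨v, Set.mem_univ v, rfl⟩

theorem mem_carrier {x : ℝ × ℝ} : x ∈ D.carrier ↔
    (∃ v, D.pos v = x) ∨ ∃ e, x ∈ (D.arc e).carrier := by
  simp [carrier, part]

theorem isCompact_part [Finite V] (s : Set V) : IsCompact (D.part s) :=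
  ((Set.toFinite s).image _).isCompact.union
    ((Set.toFinite _).isCompact_biUnion fun e _ => (D.arc e).isCompact_carrier)

theorem eventually_mem_carrier_of_openSegment [Finite V] (x : ℝ × ℝ) :
    ∀ᶠ y in 𝓝 x, ∀ z ∈ openSegment ℝ x y, z ∈ D.carrier → y ∈ D.carrier := by
  have h1 : ∀ᶠ y in 𝓝 x, ∀ v, ∀ z ∈ openSegment ℝ x y,
      z ∈ segment ℝ (D.pos v) (D.pos v) → y ∈ segment ℝ (D.pos v) (D.pos v) :=
    eventually_all.2 fun v => eventually_mem_segment_of_openSegment _ _ x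
  have h2 : ∀ᶠ y in 𝓝 x, ∀ e : G.edgeSet, ∀ i ∈ Set.Iio (D.arc e).length, ∀ z ∈ openSegment ℝ x y,
      z ∈ segment ℝ ((D.arc e).pt i) ((D.arc e).pt (i + 1)) →
        y ∈ segment ℝ ((D.arc e).pt i) ((D.arc e).pt (i + 1)) :=
    eventually_all.2 fun e => (Set.finite_Iio _).eventually_all.2 fun i _ =>
      eventually_mem_segment_of_openSegment _ _ x
  filter_upwards [h1, h2] with y hy1 hy2 z hz hzX
  rw [mem_carrier] at hzX ⊢
  rcases hzX with ⟨v, rfl⟩ | ⟨e, i, hi, hzi⟩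
  · have := hy1 v _ hz (left_mem_segment ℝ _ _)
    rw [segment_same] at this
    exact .inl ⟨v, this.symm⟩
  · exact .inr ⟨e, i, hi, hy2 e i hi z hz hzi⟩

/-- Near an inner point of an edge, the drawing consists of this edge only. -/
theorem eventually_mem_carrier_iff [Finite V] {e : G.edgeSet} {x : ℝ × ℝ}
    (hx : x ∈ (D.arc e).carrier) (hv : ∀ v, D.pos v ≠ x) :
    ∀ᶠ y in 𝓝 x, y ∈ D.carrier ↔ y ∈ (D.arc e).carrier := by
  have h1 : ∀ᶠ y in 𝓝 x, ∀ v, y ≠ D.pos v :=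
    eventually_all.2 fun v => isOpen_ne.mem_nhds (hv v).symm
  have h2 : ∀ᶠ y in 𝓝 x, ∀ e' : G.edgeSet, e' ≠ e → y ∉ (D.arc e').carrier := by
    refine eventually_all.2 fun e' => ?_
    by_cases he : e' = e
    · exact Eventually.of_forall fun y h => absurd he h
    · have hx' : x ∉ (D.arc e').carrier := fun hx' => by
        obtain ⟨v, -, -, h⟩ := D.arc_inter_arc e' e he x hx' hx
        exact hv v h.symm
      filter_upwards [(D.arc e').isCompact_carrier.isClosed.isOpen_compl.mem_nhds hx'] with y hy _
        using hy
  filter_upwards [h1, h2] with y hy1 hy2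
  rw [mem_carrier]
  constructor
  · rintro (⟨v, rfl⟩ | ⟨e', h⟩)
    · exact absurd rfl (hy1 v)
    · by_cases he : e' = e
      · rwa [← he]
      · exact absurd h (hy2 e' he)
  · exact fun h => .inr ⟨e, h⟩

/-- If an edge is adherent to a component of the complement of the drawing, then so is one of its
ends. -/
theorem exists_pos_mem_closure [Finite V] {p : ℝ × ℝ} (hp : p ∉ D.carrier) {e : G.edgeSet}
    {x : ℝ × ℝ} (hx : x ∈ (D.arc e).carrier)
    (hxc : x ∈ closure (polygonalComponent D.carrierᶜ p)) :
    ∃ v ∈ (e : Sym2 V), D.pos v ∈ closure (polygonalComponent D.carrierᶜ p) := by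
  by_contra! hcon
  set W := polygonalComponent D.carrierᶜ p
  obtain ⟨v₀, hv₀, h₀⟩ := D.exists_pos_eq_of_mem_ends (e := e) (Sym2.mem_mk_left _ _)
  -- If no end of the edge is adherent to `W`, adherence is both an open and a closed condition
  -- along the arc. The arc is connected and `x` is adherent, so its end would be too.
  have hop : IsOpen {y | ∀ᶠ z in 𝓝 y, z ∈ D.carrier → z ∈ closure W} :=
    isOpen_setOfPred_eventually_nhds
  have hmem : ∀ y ∈ (D.arc e).carrier, y ∈ closure W →
      ∀ᶠ z in 𝓝 y, z ∈ D.carrier → z ∈ closure W := by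
    intro y hy hyW
    have hyv : ∀ v, D.pos v ≠ y := by
      rintro v rfl
      exact hcon v (D.vertex_mem_arc e v hy) hyW
    have hye : ∀ q ∈ (D.arc e).ends, y ≠ q := by
      rintro q hq rfl
      obtain ⟨v, -, h⟩ := D.exists_pos_eq_of_mem_ends hq
      exact hyv v h
    obtain ⟨d₁, d₂, hd₁, hd₂, hd, hnear⟩ := (D.arc e).exists_rays hy
      (hye _ (Sym2.mem_mk_left _ _)) (hye _ (Sym2.mem_mk_right _ _))
    refine eventually_mem_closure_polygonalComponent hp hd₁ hd₂ hd ?_ hyW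
    filter_upwards [hnear, D.eventually_mem_carrier_iff hy hyv] with z h1 h2
    rw [h2, h1]
  obtain ⟨y, hy, hy1, hy2⟩ := (D.arc e).isPreconnected_carrier
    {y | ∀ᶠ z in 𝓝 y, z ∈ D.carrier → z ∈ closure W} (closure W)ᶜ hop isClosed_closure.isOpen_compl
    (fun y hy => (em (y ∈ closure W)).imp (hmem y hy) id) ⟨x, hx, hmem x hx hxc⟩
    ⟨(D.arc e).pt 0, (D.arc e).pt_zero_mem_carrier, by rw [← h₀]; exact hcon v₀ hv₀⟩
  exact hy2 (Eventually.self_of_nhds hy1 (D.arc_subset_carrier e hy))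

theorem exists_pos_mem_closure_of_mem_part [Finite V] {p : ℝ × ℝ} (hp : p ∉ D.carrier)
    {s : Set V} {x : ℝ × ℝ} (hx : x ∈ D.part s)
    (hxc : x ∈ closure (polygonalComponent D.carrierᶜ p)) :
    ∃ v ∈ s, D.pos v ∈ closure (polygonalComponent D.carrierᶜ p) := by
  rcases hx with ⟨v, hv, rfl⟩ | hx
  · exact ⟨v, hv, hxc⟩
  · simp only [Set.mem_iUnion] at hx
    obtain ⟨e, he, hx⟩ := hx
    obtain ⟨v, hv, h⟩ := D.exists_pos_mem_closure hp hx hxc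
    exact ⟨v, he v hv, h⟩

/-- A vertex adherent to a component of the complement can be reached from this component. -/
theorem polygonallyJoined_pos [Finite V] {p : ℝ × ℝ} (hp : p ∉ D.carrier) {v : V}
    (hv : D.pos v ∈ closure (polygonalComponent D.carrierᶜ p)) {U : Set (ℝ × ℝ)}
    (hU : D.carrierᶜ ⊆ U) (hvU : D.pos v ∈ U) : PolygonallyJoined U p (D.pos v) := by
  obtain ⟨r, hr, hball⟩ := Metric.eventually_nhds_iff_ball.1
    (D.eventually_mem_carrier_of_openSegment (D.pos v))
  obtain ⟨w, hw, hwv⟩ := Metric.mem_closure_iff.1 hv r hr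
  rw [_root_.dist_comm] at hwv
  have hwX : w ∈ D.carrierᶜ := PolygonallyJoined.mem hp hw
  refine (PolygonallyJoined.mono hU hw).trans (.single ?_)
  rw [segment_symm, ← insert_endpoints_openSegment]
  rintro z (rfl | rfl | hz)
  · exact hvU
  · exact hU hwX
  · exact hU fun hzX => hwX (hball w hwv z hz hzX)

/-- A new edge can be drawn along an arc that meets the drawing only in its ends. -/
theorem isPlanar_sup_edge {a b : V} (hab : a ≠ b) (A : PolygonalArc) (h0 : A.pt 0 = D.pos a)
    (h1 : A.pt A.length = D.pos b)
    (hA : A.carrier ⊆ D.carrierᶜ ∪ {D.pos a, D.pos b}) : (G ⊔ edge a b).IsPlanar := by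
  classical
  have hset : ∀ e : (G ⊔ edge a b).edgeSet, (e : Sym2 V) ∉ G.edgeSet → (e : Sym2 V) = s(a, b) := by
    rintro ⟨e, he⟩ h
    rw [edgeSet_sup, edgeSet_edge_of_ne hab] at he
    exact he.resolve_left h
  have hAend : ∀ x ∈ A.carrier, x ∈ D.carrier → x = D.pos a ∨ x = D.pos b := fun x hx hxD =>
    (hA hx).resolve_left fun h => h hxD
  have hcross : ∀ (e : G.edgeSet), ∀ x ∈ (D.arc e).carrier, x ∈ A.carrier →
      ∃ v, v ∈ (e : Sym2 V) ∧ v ∈ s(a, b) ∧ x = D.pos v := by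
    intro e x hx hxA
    rcases hAend x hxA (D.arc_subset_carrier e hx) with rfl | rfl
    · exact ⟨a, D.vertex_mem_arc e a hx, Sym2.mem_mk_left _ _, rfl⟩
    · exact ⟨b, D.vertex_mem_arc e b hx, Sym2.mem_mk_right _ _, rfl⟩
  let arc : (G ⊔ edge a b).edgeSet → PolygonalArc := fun e =>
    if h : (e : Sym2 V) ∈ G.edgeSet then D.arc ⟨e, h⟩ else A
  have hpos : ∀ (e : (G ⊔ edge a b).edgeSet) (h : (e : Sym2 V) ∈ G.edgeSet),
      arc e = D.arc ⟨e, h⟩ := fun _ h => dif_pos h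
  have hneg : ∀ e : (G ⊔ edge a b).edgeSet, (e : Sym2 V) ∉ G.edgeSet → arc e = A :=
    fun e h => dif_neg h
  refine ⟨{
    pos := D.pos
    pos_injective := D.pos_injective
    arc := arc
    arc_ends := fun e => ?_
    vertex_mem_arc := fun e v hv => ?_
    arc_inter_arc := fun e e' hne x hx hx' => ?_ }⟩
  · by_cases h : (e : Sym2 V) ∈ G.edgeSet
    · rw [hpos e h]
      exact D.arc_ends ⟨e, h⟩
    · rw [hneg e h, hset e h, PolygonalArc.ends, h0, h1]
      rfl
  · by_cases h : (e : Sym2 V) ∈ G.edgeSet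
    · rw [hpos e h] at hv
      exact D.vertex_mem_arc ⟨e, h⟩ v hv
    · rw [hneg e h] at hv
      rw [hset e h, Sym2.mem_iff]
      exact (hAend _ hv (D.pos_mem_carrier v)).imp (D.pos_injective ·) (D.pos_injective ·)
  · by_cases h : (e : Sym2 V) ∈ G.edgeSet <;> by_cases h' : (e' : Sym2 V) ∈ G.edgeSet
    · rw [hpos e h] at hx
      rw [hpos e' h'] at hx'
      exact D.arc_inter_arc ⟨e, h⟩ ⟨e', h'⟩
        (fun hh => hne (Subtype.ext (Subtype.mk_eq_mk.1 hh))) x hx hx'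
    · rw [hpos e h] at hx
      rw [hneg e' h'] at hx'
      rw [hset e' h']
      exact hcross ⟨e, h⟩ x hx hx'
    · rw [hneg e h] at hx
      rw [hpos e' h'] at hx'
      rw [hset e h]
      obtain ⟨v, k1, k2, k3⟩ := hcross ⟨e', h'⟩ x hx' hx
      exact ⟨v, k2, k1, k3⟩
    · exact absurd (Subtype.ext ((hset e h).trans (hset e' h').symm)) hne

end PlaneDrawing

/-- Two parts of a planar graph without edges in between can be joined by an edge. -/
theorem IsPlanar.exists_isPlanar_sup_edge [Finite V] (hG : G.IsPlanar) {s : Set V}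
    (hs : s.Nonempty) (hsc : sᶜ.Nonempty) (hadj : ∀ u v, G.Adj u v → (u ∈ s ↔ v ∈ s)) :
    ∃ a ∈ s, ∃ b ∈ sᶜ, (G ⊔ edge a b).IsPlanar := by
  obtain ⟨D⟩ := hG
  have hedge : ∀ e : G.edgeSet, (∀ v ∈ (e : Sym2 V), v ∈ s) ∨ ∀ v ∈ (e : Sym2 V), v ∈ sᶜ := by
    rintro ⟨e, he⟩
    induction e with
    | _ u v =>
    have := hadj u v he
    simp only [Sym2.ball, Set.mem_compl_iff]
    tauto
  have hcover : D.carrier ⊆ D.part s ∪ D.part sᶜ := by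
    intro x hx
    rcases D.mem_carrier.1 hx with ⟨v, rfl⟩ | ⟨e, hx⟩
    · exact (em (v ∈ s)).imp (fun h => .inl ⟨v, h, rfl⟩) fun h => .inl ⟨v, h, rfl⟩
    · exact (hedge e).imp (fun h => .inr (Set.mem_biUnion (x := e) h hx))
        fun h => .inr (Set.mem_biUnion (x := e) h hx)
  have hdisj : ∀ x ∈ D.part s, x ∉ D.part sᶜ := by
    rintro x (⟨v, hv, rfl⟩ | hx) (⟨v', hv', h⟩ | hx')
    · exact hv' (D.pos_injective h ▸ hv)
    · simp only [Set.mem_iUnion] at hx'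
      obtain ⟨e, he, hx'⟩ := hx'
      exact he v (D.vertex_mem_arc e v hx') hv
    · subst h
      simp only [Set.mem_iUnion] at hx
      obtain ⟨e, he, hx⟩ := hx
      exact hv' (he v' (D.vertex_mem_arc e v' hx))
    · simp only [Set.mem_iUnion] at hx hx'
      obtain ⟨e, he, hx⟩ := hx
      obtain ⟨e', he', hx'⟩ := hx'
      by_cases hee : e = e'
      · subst hee
        obtain ⟨v, hv, -⟩ := D.exists_pos_eq_of_mem_ends (e := e) (Sym2.mem_mk_left _ _)
        exact he' v hv (he v hv)
      · obtain ⟨v, hv, hv', -⟩ := D.arc_inter_arc e e' hee x hx hx'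
        exact he' v hv' (he v hv)
  have hne : ∀ t : Set V, t.Nonempty → (D.part t).Nonempty := fun t ⟨v, hv⟩ =>
    ⟨D.pos v, .inl ⟨v, hv, rfl⟩⟩
  obtain ⟨p, x, hx, y, hy, hp, hpx, hpy⟩ := exists_openSegment_subset_compl (D.isCompact_part s)
    (D.isCompact_part sᶜ) (hne s hs) (hne _ hsc) (Set.disjoint_left.2 hdisj)
  replace hp : p ∉ D.carrier := fun h => hp (hcover h)
  have hclose : ∀ w, openSegment ℝ p w ⊆ (D.part s ∪ D.part sᶜ)ᶜ →
      w ∈ closure (polygonalComponent D.carrierᶜ p) := fun w hw =>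
    mem_closure_polygonalComponent hp Relation.ReflTransGen.refl
      (hw.trans (Set.compl_subset_compl.2 hcover))
  obtain ⟨a, ha, hac⟩ := D.exists_pos_mem_closure_of_mem_part hp hx
    (hclose x hpx)
  obtain ⟨b, hb, hbc⟩ := D.exists_pos_mem_closure_of_mem_part hp hy
    (hclose y hpy)
  have hab : a ≠ b := fun h => hb (h ▸ ha)
  -- The chain runs from `a` through `p` to `b`. It may touch the drawing in these two vertices
  -- only, as required of a new edge.
  have hj := (D.polygonallyJoined_pos (U := D.carrierᶜ ∪ {D.pos a, D.pos b}) hp hac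
    Set.subset_union_left (.inr (.inl rfl))).symm.trans
    (D.polygonallyJoined_pos hp hbc Set.subset_union_left (.inr (.inr rfl)))
  obtain ⟨A, hA0, hA1, hA⟩ := hj.exists_arc (D.pos_injective.ne hab)
  exact ⟨a, ha, b, hb, D.isPlanar_sup_edge hab A hA0 hA1 hA⟩

/-- Otherwise an edge could be added between the component of some vertex and the remaining
vertices. By maximality that edge already belongs to `G`, which contradicts the choice of the
component. -/
theorem IsMaximalPlanar.connected [Finite V] [Nonempty V] (hG : G.IsMaximalPlanar) :
    G.Connected := by
  refine ⟨?_⟩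
  by_contra hcon
  rw [Preconnected] at hcon
  push Not at hcon
  obtain ⟨u, v, huv⟩ := hcon
  obtain ⟨a, ha, b, hb, hab⟩ := hG.prop.exists_isPlanar_sup_edge (s := {w | G.Reachable u w})
    ⟨u, Reachable.refl u⟩ ⟨v, huv⟩ fun x y h =>
      ⟨fun hx => Reachable.trans hx h.reachable, fun hy => Reachable.trans hy h.symm.reachable⟩
  have hne : a ≠ b := fun h => hb (h ▸ ha)
  have hle := hG.le_of_ge hab le_sup_left
  have hadj : G.Adj a b := hle (.inr ((edge_adj ..).2 ⟨.inl ⟨rfl, rfl⟩, hne⟩))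
  exact hb (Reachable.trans ha hadj.reachable)

end SimpleGraph

end

theorem theorem5p6 :
    (∀ (V : Type*) [Fintype V] (G : SimpleGraph V), G.IsMaximalPlanar → 7 ≤ Fintype.card V →
      ∀ f : Sym2 V → ℤ, G.IsSignColouring f →
        3 * ((Fintype.card V - 1) / 2) - 5 ≤ min (G.colourCount f (-1)) (G.colourCount f 1) →
          G.HasBalancedSpanningTree f) ∧
    (∀ n : ℕ, 7 ≤ n →
      ∃ (G : SimpleGraph (Fin n)) (f : Sym2 (Fin n) → ℤ),
        G.IsMaximalPlanar ∧ G.IsSignColouring f ∧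
        min (G.colourCount f (-1)) (G.colourCount f 1) = 3 * ((n - 1) / 2) - 6 ∧
        ¬ G.HasBalancedSpanningTree f) := by
  refine ⟨fun V _ G hG hn f hf hmin => ?_, fun n hn =>
    SimpleGraph.exists_maximalPlanar_not_hasBalancedSpanningTree hn⟩
  have : Nonempty V := Fintype.card_pos_iff.1 (by omega)
  exact hG.prop.hasBalancedSpanningTree hG.connected hn hf hmin
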